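/- **Setting.** Let $\mathcal X$ be a separable metric space, $\mathcal Y$ a real separable Hilbert space, $\Gamma$ a countable set, and $(\varphi_\gamma)_{\gamma\in\Gamma}$ measurable functions $\mathcal X\to\mathcal Y$ with $\sum_{\gamma}|\varphi_\gamma(x)|^2\le\kappa<\infty$ for all $x$. For $\beta\in\ell_2=\ell_2(\Gamma)$ put $f_\beta(x)=\sum_\gamma\beta_\gamma\varphi_\gamma(x)$. Let $w_\gamma\ge 0$, and for $\varepsilon\ge 0$ let $p_\varepsilon(\beta)=\sum_\gamma (w_\gamma|\beta_\gamma|+\varepsilon\beta_\gamma^2)\in[0,\infty]$. Let $P$ be the law of a pair $(X,Y)$ in $\mathcal X\times\mathcal Y$ such that $Y=f^*(X)+W$, where $f^*=f_{\beta^*}$ for some $\beta^*\in\ell_2$ with $\sum_\gamma w_\gamma|\beta^*_\gamma|<\infty$, $\mathbb E[W\mid X]=0$, and $\mathbb E\big[e^{|W|/L}-|W|/L-1\,\big|\,X\big]\le \sigma^2/(2L^2)$ for some $\sigma,L>0$. Let $(X_i,Y_i)_{i\ge 1}$ be i.i.d. with law $P$. An elastic-net estimator $\beta_n^{\lambda}$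 ($\lambda>0$, $n\ge 1$) is a minimizer over $\ell_2$ of $\frac1n\sum_{i=1}^n|Y_i-f_\beta(X_i)|^2+\lambda p_\varepsilon(\beta)$. An elastic-net representation $\beta^\varepsilon$ is a minimizer of $p_\varepsilon$ over $\{\beta\in\ell_2: f_\beta(X)=f^*(X)\text{ almost surely}\}$. Let $\lambda_n>0$ $(n\ge1)$ be a deterministic sequence with $\lambda_n\to 0$. **Theorem.** (i) Let $\varepsilon>0$. Then $\beta^\varepsilon$ exists and is unique, and for every $n\ge 1$ and every sample so does $\beta_n^{\lambda_n}$. If $n\lambda_n^2-2\log n\to+\infty$, then with probability 1 $$\lim_{n\to\infty}\|\beta_n^{\lambda_n}-\beta^\varepsilon\|_2=0 .$$ (ii) Let $\varepsilon\ge 0$ and suppose that there is $\kappa_0>0$ with $\mathbb E|f_\beta(X)|^2\ge\kappa_0$ for all $\beta\in\ell_2$ with $\|\beta\|_2=1$. Then $\beta^\varepsilon$ exists and is unique; with probability 1, $\beta_n^{\lambda_n}$ exists and is unique for all sufficiently large $n$, and $\lim_{n\to\infty}\|\beta_n^{\lambda_n}-\beta^\varepsilon\|_2=0$ (with no further condition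 on $\lambda_n$). In both cases, with probability 1, $f_n=f_{\beta_n^{\lambda_n}}$ satisfies $\lim_{n\to\infty}\int|f_n(x)-f^*(x)|^2\,dP(x,y)=0$. -/

import Mathlib

open MeasureTheory ProbabilityTheory Filter Topology
open scoped ENNReal

namespace ElasticNet

/-- The Hilbert space `ℓ₂` of square-summable real families indexed by `Γ`. -/
abbrev Ell2 (Γ : Type*) : Type _ := lp (fun _ : Γ => ℝ) 2

noncomputable section

/-- The function `f_β(x) = ∑_γ β_γ φ_γ(x)` attached to a coefficient vector `β ∈ ℓ₂`. -/
def predictor {Γ 𝓧 𝓨 : Type*} [NormedAddCommGroup 𝓨] [InnerProductSpace ℝ 𝓨]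
    (φ : Γ → 𝓧 → 𝓨) (β : Ell2 Γ) (x : 𝓧) : 𝓨 :=
  ∑' γ, β γ • φ γ x

/-- The elastic-net penalty `p_ε(β) = ∑_γ (w_γ |β_γ| + ε β_γ²) ∈ [0, ∞]`
(for `w_γ ≥ 0` and `ε ≥ 0`). -/
def penalty {Γ : Type*} (w : Γ → ℝ) (ε : ℝ) (β : Ell2 Γ) : ℝ≥0∞ :=
  ∑' γ, ENNReal.ofReal (w γ * |β γ| + ε * β γ ^ 2)

/-- The penalized empirical risk
`(1/n) ∑_{i<n} ‖y_i - f_β(x_i)‖² + lam * p_ε(β) ∈ [0, ∞]` of the first `n` points of a sample. -/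
def empiricalFunctional {Γ 𝓧 𝓨 : Type*} [NormedAddCommGroup 𝓨] [InnerProductSpace ℝ 𝓨]
    (φ : Γ → 𝓧 → 𝓨) (w : Γ → ℝ) (ε lam : ℝ) (n : ℕ) (x : ℕ → 𝓧) (y : ℕ → 𝓨)
    (β : Ell2 Γ) : ℝ≥0∞ :=
  ENNReal.ofReal ((1 / (n : ℝ)) * ∑ i ∈ Finset.range n, ‖y i - predictor φ β (x i)‖ ^ 2)
    + ENNReal.ofReal lam * penalty w ε β

/-- `β` is an elastic-net estimator: a minimizer over `ℓ₂` of the penalized empirical risk. -/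
def IsEstimator {Γ 𝓧 𝓨 : Type*} [NormedAddCommGroup 𝓨] [InnerProductSpace ℝ 𝓨]
    (φ : Γ → 𝓧 → 𝓨) (w : Γ → ℝ) (ε lam : ℝ) (n : ℕ) (x : ℕ → 𝓧) (y : ℕ → 𝓨)
    (β : Ell2 Γ) : Prop :=
  ∀ β' : Ell2 Γ,
    empiricalFunctional φ w ε lam n x y β ≤ empiricalFunctional φ w ε lam n x y β'

/-- The features are measurable and `k(x) = ∑_γ ‖φ_γ(x)‖² ≤ κ` for every `x`. -/
structure BoundedFeatures {Γ 𝓧 𝓨 : Type*} [MeasurableSpace 𝓧]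
    [NormedAddCommGroup 𝓨] [MeasurableSpace 𝓨] (φ : Γ → 𝓧 → 𝓨) (κ : ℝ) : Prop where
  measurable : ∀ γ, Measurable (φ γ)
  summable : ∀ x, Summable fun γ => ‖φ γ x‖ ^ 2
  bound : ∀ x, ∑' γ, ‖φ γ x‖ ^ 2 ≤ κ

/-- The noise `W = Y - f_{β*}(X)`, as a function on `𝓧 × 𝓨`. -/
def noise {Γ 𝓧 𝓨 : Type*} [NormedAddCommGroup 𝓨] [InnerProductSpace ℝ 𝓨]
    (φ : Γ → 𝓧 → 𝓨) (βstar : Ell2 Γ) (z : 𝓧 × 𝓨) : 𝓨 :=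
  z.2 - predictor φ βstar z.1

/-- The function `exp(‖W‖/L) - ‖W‖/L - 1` of the noise. -/
def noiseExp {Γ 𝓧 𝓨 : Type*} [NormedAddCommGroup 𝓨] [InnerProductSpace ℝ 𝓨]
    (φ : Γ → 𝓧 → 𝓨) (βstar : Ell2 Γ) (L : ℝ) (z : 𝓧 × 𝓨) : ℝ :=
  Real.exp (‖noise φ βstar z‖ / L) - ‖noise φ βstar z‖ / L - 1

/-- The σ-algebra generated by the first coordinate `X` on `𝓧 × 𝓨`. -/
abbrev sigmaX (𝓧 𝓨 : Type*) [m𝓧 : MeasurableSpace 𝓧] : MeasurableSpace (𝓧 × 𝓨) :=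
  MeasurableSpace.comap Prod.fst m𝓧

/-- The regression model `Y = f_{β*}(X) + W` for a pair `(X, Y)` of law `P`, where
`∑_γ w_γ |β*_γ| < ∞`, `E[W | X] = 0` and
`E[exp(‖W‖/L) - ‖W‖/L - 1 | X] ≤ σ² / (2 L²)`. -/
structure RegressionModel {Γ 𝓧 𝓨 : Type*} [MeasurableSpace 𝓧] [NormedAddCommGroup 𝓨]
    [InnerProductSpace ℝ 𝓨] [CompleteSpace 𝓨] [MeasurableSpace 𝓨]
    (φ : Γ → 𝓧 → 𝓨) (w : Γ → ℝ) (βstar : Ell2 Γ) (σ L : ℝ) (P : Measure (𝓧 × 𝓨)) : Prop where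
  sparse : Summable fun γ => w γ * |βstar γ|
  sigma_pos : 0 < σ
  L_pos : 0 < L
  integrable_noise : Integrable (noise φ βstar) P
  integrable_noiseExp : Integrable (noiseExp φ βstar L) P
  zero_mean : P[noise φ βstar | sigmaX 𝓧 𝓨] =ᵐ[P] 0
  noise_bound : P[noiseExp φ βstar L | sigmaX 𝓧 𝓨] ≤ᵐ[P] fun _ => σ ^ 2 / (2 * L ^ 2)

/-- `(X_i, Y_i)` are independent random pairs, each of law `P`. -/
structure IIDSample {Ω 𝓧 𝓨 : Type*} [MeasurableSpace Ω] [MeasurableSpace 𝓧] [MeasurableSpace 𝓨]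
    (μ : Measure Ω) (P : Measure (𝓧 × 𝓨)) (X : ℕ → Ω → 𝓧) (Y : ℕ → Ω → 𝓨) : Prop where
  measurable : ∀ i, Measurable fun ω => (X i ω, Y i ω)
  indep : iIndepFun (fun i ω => (X i ω, Y i ω)) μ
  law : ∀ i, μ.map (fun ω => (X i ω, Y i ω)) = P

/-- `β` is an elastic-net representation of the regression function `f_{β*}`: it satisfies
`f_β(X) = f_{β*}(X)` almost surely and has the least penalty among all such vectors. -/
def IsRepresentation {Γ 𝓧 𝓨 : Type*} [MeasurableSpace 𝓧] [NormedAddCommGroup 𝓨]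
    [InnerProductSpace ℝ 𝓨] [MeasurableSpace 𝓨]
    (φ : Γ → 𝓧 → 𝓨) (w : Γ → ℝ) (ε : ℝ) (P : Measure (𝓧 × 𝓨)) (βstar β : Ell2 Γ) : Prop :=
  (∀ᵐ z ∂P, predictor φ β z.1 = predictor φ βstar z.1) ∧
    ∀ β' : Ell2 Γ, (∀ᵐ z ∂P, predictor φ β' z.1 = predictor φ βstar z.1) →
      penalty w ε β ≤ penalty w ε β'

/-- `κ₀` is a lower bound for `⟪Φ_P^* Φ_P β, β⟫ = ‖Φ_P β‖²_{L²(P)} = E ‖f_β(X)‖²` over the unit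
sphere of `ℓ₂`, where `Φ_P β = f_β` in `L²(P)`. -/
def IsLowerSpectralBound {Γ 𝓧 𝓨 : Type*} [MeasurableSpace 𝓧] [NormedAddCommGroup 𝓨]
    [InnerProductSpace ℝ 𝓨] [MeasurableSpace 𝓨]
    (φ : Γ → 𝓧 → 𝓨) (P : Measure (𝓧 × 𝓨)) (κ₀ : ℝ) : Prop :=
  ∀ β : Ell2 Γ, ‖β‖ = 1 → ENNReal.ofReal κ₀ ≤ ∫⁻ z, ‖predictor φ β z.1‖ₑ ^ 2 ∂P

/-- The squared `L²(P)` distance `E ‖f_β(X) - f_{β'}(X)‖²`. -/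
def predictionError {Γ 𝓧 𝓨 : Type*} [MeasurableSpace 𝓧] [NormedAddCommGroup 𝓨]
    [InnerProductSpace ℝ 𝓨] [MeasurableSpace 𝓨]
    (φ : Γ → 𝓧 → 𝓨) (P : Measure (𝓧 × 𝓨)) (β β' : Ell2 Γ) : ℝ≥0∞ :=
  ∫⁻ z, ‖predictor φ β z.1 - predictor φ β' z.1‖ₑ ^ 2 ∂P

end

end ElasticNet

/-! Expanding the empirical risk exactly around a vector `β₀` with `f_β₀ = f*` almost surely, and
comparing the estimator with `β₀`, gives (`BoundedFeatures.basic_inequality`), with `u = β_n - β₀`,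
⟨G_n u, u⟩ + λ p(β_n) ≤ λ p(β₀) + 2 ‖s_n‖ ‖u‖. Here G_n is the mean of the operators Φ_x* Φ_x and
s_n the mean of Φ_x* applied to the noise. The summands of s_n are i.i.d., centred and in L⁴. By the
strong law in operator norm, G_n tends to the covariance T.

For ε > 0, put `β₀ = βε` and divide by λ. If ‖s_n‖/λ_n → 0, the ε-term of the penalty keeps β_n
bounded, so p(β_n) ≤ p(βε) + o(1) and ⟨T u, u⟩ → 0. Thus β_n eventually enters each closed convex
set {⟨T(β - βε), β - βε⟩ ≤ δ}. These sets decrease to the set of all representations of f*, on which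
βε minimizes the strongly convex, lower semicontinuous p. Strong convexity then forces norm
convergence (`MidpointStronglyConvex.tendsto_minimizer`), with no weak compactness argument.

That ‖s_n‖ = o(λ_n) follows from `ae_tendsto_norm_sum_pow_four_div`: fourth moments, Doob's maximal
inequality on dyadic blocks and Borel–Cantelli make a centred Hilbert-valued walk o(√(n log n)),
which suffices when nλ_n² ≥ 2 log n.

Under a spectral bound κ₀, `βstar` is the only representation and G_n is eventually bounded below by
κ₀/2. The basic inequality is then quadratic in ‖u‖ with coefficients tending to 0, so s_n → 0 (the
strong law) is enough. Prediction error is at most κ ‖u‖² in both cases. -/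

namespace ElasticNet

/-! ### Strongly convex minimization over nested closed convex sets -/

section Convex

variable {H : Type*} [NormedAddCommGroup H] [NormedSpace ℝ H]

/-- Strong convexity with modulus `c`, tested at midpoints only. -/
def MidpointStronglyConvex (c : ℝ) (F : H → ℝ≥0∞) : Prop :=
  ∀ a b, 2 * F (midpoint ℝ a b) + ENNReal.ofReal (c * ‖a - b‖ ^ 2) ≤ F a + F b

/-- Near-minimizers on `K k` form a Cauchy sequence: the midpoint of the `k`-th and a later one
stays in `K k`, so its value is at least the infimum there, and strong convexity bounds their
distance by the remaining increase of the infima. The limit lies in every set, and lower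
semicontinuity bounds its value. This replaces weak compactness. -/
theorem MidpointStronglyConvex.exists_mem_iInter_le [CompleteSpace H] {c : ℝ} (hc : 0 < c)
    {F : H → ℝ≥0∞} (hF : MidpointStronglyConvex c F) (hlsc : LowerSemicontinuous F)
    {K : ℕ → Set H} (hK : Antitone K) (hconv : ∀ k, Convex ℝ (K k)) (hclosed : ∀ k, IsClosed (K k))
    (hfin : ⨆ k, ⨅ x ∈ K k, F x ≠ ∞) :
    ∃ x, (∀ k, x ∈ K k) ∧ F x ≤ ⨆ k, ⨅ x ∈ K k, F x := by
  set v : ℕ → ℝ≥0∞ := fun k => ⨅ x ∈ K k, F x with hv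
  set V := ⨆ k, v k with hV
  have hvV : ∀ k, v k ≤ V := fun k => le_iSup v k
  have hvfin : ∀ k, v k ≠ ∞ := fun k => ne_top_of_le_ne_top hfin (hvV k)
  have hvmono : Monotone v := fun i j hij => biInf_mono (hK hij)
  have hex : ∀ k : ℕ, ∃ x ∈ K k, F x < v k + ENNReal.ofReal (1 / ((k : ℝ) + 1)) := by
    intro k
    have h : v k < v k + ENNReal.ofReal (1 / ((k : ℝ) + 1)) :=
      ENNReal.lt_add_right (hvfin k) (by simp; positivity)
    rw [hv] at h
    simpa only [iInf_lt_iff, exists_prop] using h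
  choose x hxK hxF using hex
  have hvt : Tendsto v atTop (𝓝 V) := tendsto_atTop_iSup hvmono
  have hvr : Tendsto (fun k => (v k).toReal) atTop (𝓝 V.toReal) :=
    (ENNReal.tendsto_toReal hfin).comp hvt
  have hone : Tendsto (fun k : ℕ => 1 / ((k : ℝ) + 1)) atTop (𝓝 0) :=
    tendsto_one_div_add_atTop_nhds_zero_nat
  have key : ∀ k l, k ≤ l →
      c * ‖x k - x l‖ ^ 2 ≤ V.toReal - (v k).toReal + 2 * (1 / ((k : ℝ) + 1)) := by
    intro k l hkl
    have hm : midpoint ℝ (x k) (x l) ∈ K k := (hconv k).midpoint_mem (hxK k) (hK hkl (hxK l))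
    have h1 : v k ≤ F (midpoint ℝ (x k) (x l)) := biInf_le F hm
    have hkl' : (1 : ℝ) / ((l : ℝ) + 1) ≤ 1 / ((k : ℝ) + 1) := by
      have : (k : ℝ) ≤ l := by exact_mod_cast hkl
      gcongr
    have h2 : 2 * v k + ENNReal.ofReal (c * ‖x k - x l‖ ^ 2) ≤
        (v k + ENNReal.ofReal (1 / ((k : ℝ) + 1))) + (V + ENNReal.ofReal (1 / ((k : ℝ) + 1))) :=
      calc _ ≤ 2 * F (midpoint ℝ (x k) (x l)) + ENNReal.ofReal (c * ‖x k - x l‖ ^ 2) := by gcongr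
        _ ≤ F (x k) + F (x l) := hF _ _
        _ ≤ _ := by
          refine add_le_add (hxF k).le ((hxF l).le.trans ?_)
          exact add_le_add (hvV l) (ENNReal.ofReal_le_ofReal hkl')
    have hpos : (0 : ℝ) ≤ 1 / ((k : ℝ) + 1) := by positivity
    have h3 := ENNReal.toReal_mono (by simp [hvfin k, hfin]) h2
    rw [ENNReal.toReal_add (ENNReal.mul_ne_top (by simp) (hvfin k)) (by simp),
      ENNReal.toReal_add (by simp [hvfin k]) (by simp [hfin]),
      ENNReal.toReal_add (hvfin k) (by simp), ENNReal.toReal_add hfin (by simp),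
      ENNReal.toReal_mul, ENNReal.toReal_ofReal (by positivity),
      ENNReal.toReal_ofReal hpos] at h3
    simp only [ENNReal.toReal_ofNat] at h3
    linarith
  have hrho : Tendsto (fun k : ℕ => √((V.toReal - (v k).toReal + 2 * (1 / ((k : ℝ) + 1))) / c))
      atTop (𝓝 0) := by
    have := ((hvr.const_sub V.toReal).add (hone.const_mul 2)).div_const c
    have := (Real.continuous_sqrt.tendsto _).comp this
    simpa [Function.comp_def] using this
  have hcauchy : CauchySeq x := by
    refine cauchySeq_of_le_tendsto_0' _ (fun k l hkl => ?_) hrho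
    rw [dist_eq_norm]
    refine Real.le_sqrt_of_sq_le ?_
    rw [le_div_iff₀ hc]
    linarith [key k l hkl]
  obtain ⟨y, hy⟩ := cauchySeq_tendsto_of_complete hcauchy
  refine ⟨y, fun k => (hclosed k).mem_of_tendsto hy ?_, ?_⟩
  · filter_upwards [eventually_ge_atTop k] with l hl using hK hl (hxK l)
  · have h1 : F y ≤ liminf (fun k => F (x k)) atTop :=
      ((lowerSemicontinuous_iff_le_liminf.1 hlsc) y).trans (liminf_le_liminf_of_le hy)
    refine h1.trans ?_
    have h2 : Tendsto (fun k : ℕ => v k + ENNReal.ofReal (1 / ((k : ℝ) + 1))) atTop (𝓝 V) := by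
      have := hvt.add (ENNReal.tendsto_ofReal hone)
      simpa using this
    rw [← h2.liminf_eq]
    exact liminf_le_liminf (Eventually.of_forall fun k => (hxF k).le)

theorem MidpointStronglyConvex.existsUnique_minimizer [CompleteSpace H] {c : ℝ} (hc : 0 < c)
    {F : H → ℝ≥0∞} (hF : MidpointStronglyConvex c F) (hlsc : LowerSemicontinuous F)
    {K : Set H} (hconv : Convex ℝ K) (hclosed : IsClosed K) {a : H} (ha : a ∈ K)
    (hfin : F a ≠ ∞) : ∃! x, x ∈ K ∧ ∀ y ∈ K, F x ≤ F y := by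
  have hle : ⨆ _ : ℕ, ⨅ x ∈ K, F x = ⨅ x ∈ K, F x := iSup_const
  obtain ⟨x, hx, hmin⟩ := hF.exists_mem_iInter_le hc hlsc (K := fun _ => K) antitone_const
    (fun _ => hconv) (fun _ => hclosed) (by
      rw [hle]; exact ne_top_of_le_ne_top hfin (biInf_le F ha))
  rw [hle] at hmin
  have hxmin : ∀ y ∈ K, F x ≤ F y := fun y hy => hmin.trans (biInf_le F hy)
  refine ⟨x, ⟨hx 0, hxmin⟩, fun y ⟨hy, hymin⟩ => ?_⟩
  have hxfin : F x ≠ ∞ := ne_top_of_le_ne_top hfin (hxmin a ha)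
  have hxy : F y = F x := le_antisymm (hymin x (hx 0)) (hxmin y hy)
  have h1 := hF y x
  have h2 : F x ≤ F (midpoint ℝ y x) := hxmin _ (hconv.midpoint_mem hy (hx 0))
  rw [hxy, ← two_mul] at h1
  have h3 : 2 * F x + ENNReal.ofReal (c * ‖y - x‖ ^ 2) ≤ 2 * F x + 0 := by
    rw [add_zero]; exact le_trans (by gcongr) h1
  have h4 := (ENNReal.add_le_add_iff_left (ENNReal.mul_ne_top (by simp) hxfin)).1 h3
  have h5 : c * ‖y - x‖ ^ 2 ≤ 0 := ENNReal.ofReal_eq_zero.1 (le_antisymm h4 bot_le)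
  have h6 : ‖y - x‖ ^ 2 ≤ 0 := nonpos_of_mul_nonpos_right h5 hc
  have h7 : ‖y - x‖ = 0 := by
    by_contra h
    have : 0 < ‖y - x‖ ^ 2 := by positivity
    linarith
  exact sub_eq_zero.1 (norm_eq_zero.1 h7)

/-- By the previous existence result, the infima over `K k` increase to `F a`. The midpoint of `b n`
and `a` lies in `K k` for large `n`, so strong convexity bounds `c * ‖b n - a‖ ^ 2` by twice the gap
between `F a` and the infimum, plus `|r n|`. -/
theorem MidpointStronglyConvex.tendsto_minimizer [CompleteSpace H] {c : ℝ} (hc : 0 < c)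
    {F : H → ℝ≥0∞} (hF : MidpointStronglyConvex c F) (hlsc : LowerSemicontinuous F)
    {K : ℕ → Set H} (hK : Antitone K) (hconv : ∀ k, Convex ℝ (K k)) (hclosed : ∀ k, IsClosed (K k))
    {a : H} (ha : ∀ k, a ∈ K k) (hfin : F a ≠ ∞) (hmin : ∀ x, (∀ k, x ∈ K k) → F a ≤ F x)
    {b : ℕ → H} (hb : ∀ k, ∀ᶠ n in atTop, b n ∈ K k) {r : ℕ → ℝ} (hr : Tendsto r atTop (𝓝 0))
    (hbF : ∀ᶠ n in atTop, F (b n) ≤ F a + ENNReal.ofReal (r n)) :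
    Tendsto b atTop (𝓝 a) := by
  set v : ℕ → ℝ≥0∞ := fun k => ⨅ x ∈ K k, F x with hv
  have hva : ∀ k, v k ≤ F a := fun k => biInf_le F (ha k)
  have hvfin : ∀ k, v k ≠ ∞ := fun k => ne_top_of_le_ne_top hfin (hva k)
  have hVa : ⨆ k, v k ≤ F a := iSup_le hva
  have hV : ⨆ k, v k = F a := by
    refine le_antisymm hVa ?_
    obtain ⟨x, hx, hxV⟩ := hF.exists_mem_iInter_le hc hlsc hK hconv hclosed
      (ne_top_of_le_ne_top hfin hVa)
    exact (hmin x hx).trans hxV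
  have hvt : Tendsto v atTop (𝓝 (F a)) := by
    rw [← hV]; exact tendsto_atTop_iSup fun i j hij => biInf_mono (hK hij)
  have hvr : Tendsto (fun k => (v k).toReal) atTop (𝓝 (F a).toReal) :=
    (ENNReal.tendsto_toReal hfin).comp hvt
  have hbound : ∀ k, ∀ᶠ n in atTop,
      c * ‖b n - a‖ ^ 2 ≤ 2 * ((F a).toReal - (v k).toReal) + |r n| := by
    intro k
    filter_upwards [hb k, hbF] with n hn hnF
    have h1 : v k ≤ F (midpoint ℝ (b n) a) := biInf_le F ((hconv k).midpoint_mem hn (ha k))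
    have h2 : 2 * v k + ENNReal.ofReal (c * ‖b n - a‖ ^ 2) ≤
        F a + ENNReal.ofReal |r n| + F a :=
      calc _ ≤ 2 * F (midpoint ℝ (b n) a) + ENNReal.ofReal (c * ‖b n - a‖ ^ 2) := by gcongr
        _ ≤ F (b n) + F a := hF _ _
        _ ≤ _ := by
          gcongr
          exact hnF.trans (by gcongr; exact le_abs_self _)
    have h3 := ENNReal.toReal_mono (by simp [hfin]) h2
    rw [ENNReal.toReal_add (ENNReal.mul_ne_top (by simp) (hvfin k)) (by simp),
      ENNReal.toReal_add (by simp [hfin]) hfin,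
      ENNReal.toReal_add hfin (by simp),
      ENNReal.toReal_mul, ENNReal.toReal_ofReal (by positivity),
      ENNReal.toReal_ofReal (abs_nonneg _)] at h3
    simp only [ENNReal.toReal_ofNat] at h3
    linarith
  rw [tendsto_iff_norm_sub_tendsto_zero, Metric.tendsto_atTop']
  intro δ hδ
  have hpos : 0 < c * δ ^ 2 / 4 := by positivity
  obtain ⟨k, hk⟩ := (hvr.eventually (lt_mem_nhds (sub_lt_self (F a).toReal hpos))).exists
  have hr' : Tendsto (fun n => |r n|) atTop (𝓝 0) := by simpa using hr.abs
  obtain ⟨N, hN⟩ := eventually_atTop.1 ((hbound k).and (hr'.eventually (gt_mem_nhds hpos)))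
  refine ⟨N, fun n hn => ?_⟩
  obtain ⟨h1, h2⟩ := hN n hn.le
  rw [Real.dist_eq, sub_zero, abs_of_nonneg (norm_nonneg _)]
  refine lt_of_pow_lt_pow_left₀ 2 hδ.le ?_
  have : c * ‖b n - a‖ ^ 2 < c * δ ^ 2 := by nlinarith
  exact lt_of_mul_lt_mul_left this hc.le

end Convex

/-! ### Moments and maximal inequality for Hilbert-valued random walks -/

section RandomWalk

variable {Ω E : Type*} [MeasurableSpace Ω] {μ : Measure Ω}

theorem integrable_norm_pow_of_memLp_four [IsFiniteMeasure μ] [NormedAddCommGroup E] {f : Ω → E}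
    (hf : MemLp f 4 μ) {p : ℕ} (hp : p ≤ 4) : Integrable (fun ω => ‖f ω‖ ^ p) μ := by
  have h : MemLp f (p : ℝ≥0∞) μ := hf.mono_exponent (by exact_mod_cast hp)
  exact h.integrable_norm_pow'

theorem memLp_sum_range [NormedAddCommGroup E] {ξ : ℕ → Ω → E} (hξ4 : ∀ i, MemLp (ξ i) 4 μ)
    (n : ℕ) : MemLp (fun ω => ∑ i ∈ Finset.range n, ξ i ω) 4 μ :=
  memLp_finsetSum _ fun i _ => hξ4 i

theorem indepFun_sum_range [NormedAddCommGroup E] [MeasurableSpace E] [BorelSpace E]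
    [SecondCountableTopology E] {ξ : ℕ → Ω → E} (hind : iIndepFun ξ μ)
    (hmeas : ∀ i, Measurable (ξ i)) (n : ℕ) :
    IndepFun (fun ω => ∑ i ∈ Finset.range n, ξ i ω) (ξ n) μ := by
  have := hind.indepFun_finsetSum_of_notMem hmeas (s := Finset.range n) (i := n) (by simp)
  convert this using 1
  ext ω
  simp

variable [NormedAddCommGroup E] [InnerProductSpace ℝ E]

theorem integrable_sq_norm_smul_of_memLp_four [IsFiniteMeasure μ] {f : Ω → E} (hf : MemLp f 4 μ) :
    Integrable (fun ω => ‖f ω‖ ^ 2 • f ω) μ := by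
  refine (integrable_norm_pow_of_memLp_four hf (p := 3) (by norm_num)).mono'
    ((hf.1.norm.pow 2).smul hf.1) (Eventually.of_forall fun ω => ?_)
  rw [norm_smul, norm_pow, norm_norm, ← pow_succ]

/-- The term linear in `x` is kept exact, since it has mean zero for centred `x` independent of `s`.
The cubic cross term is absorbed by `4 t ‖x‖² ≤ 2 t² + 2 ‖x‖⁴` with `t = ⟨s, x⟩`, then
Cauchy–Schwarz: 8 = 2 + 4 + 2 and 3 = 1 + 2. -/
theorem norm_add_pow_four_le (s x : E) :
    ‖s + x‖ ^ 4 ≤ ‖s‖ ^ 4 + 4 * inner ℝ (‖s‖ ^ 2 • s) x + 8 * (‖s‖ ^ 2 * ‖x‖ ^ 2) + 3 * ‖x‖ ^ 4 := by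
  have h := norm_add_sq_real s x
  have h1 : ‖s + x‖ ^ 4 = (‖s‖ ^ 2 + 2 * inner ℝ s x + ‖x‖ ^ 2) ^ 2 := by rw [← h]; ring
  rw [h1, real_inner_smul_left]
  have h2 : inner ℝ s x ^ 2 ≤ ‖s‖ ^ 2 * ‖x‖ ^ 2 := by
    rw [← mul_pow, ← sq_abs]
    exact pow_le_pow_left₀ (abs_nonneg _) (abs_real_inner_le_norm s x) 2
  nlinarith [sq_nonneg (inner ℝ s x - ‖x‖ ^ 2)]

/-- The subgradient inequality for `‖·‖⁴`: the difference of the two sides is `(2⟨s, x⟩ + ‖x‖²)² +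
2‖s‖²‖x‖²`. -/
theorem le_norm_add_pow_four (s x : E) :
    ‖s‖ ^ 4 + 4 * inner ℝ (‖s‖ ^ 2 • s) x ≤ ‖s + x‖ ^ 4 := by
  have h := norm_add_sq_real s x
  have h1 : ‖s + x‖ ^ 4 = (‖s‖ ^ 2 + 2 * inner ℝ s x + ‖x‖ ^ 2) ^ 2 := by rw [← h]; ring
  rw [h1, real_inner_smul_left]
  nlinarith [sq_nonneg (2 * inner ℝ s x + ‖x‖ ^ 2), mul_nonneg (sq_nonneg ‖s‖) (sq_nonneg ‖x‖)]

variable [IsProbabilityMeasure μ] [MeasurableSpace E] [BorelSpace E]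

theorem integrable_inner_sq_norm_smul {S x : Ω → E} (hS : MemLp S 4 μ) (hx : MemLp x 4 μ)
    (hind : IndepFun S x μ) : Integrable (fun ω => inner ℝ (‖S ω‖ ^ 2 • S ω) (x ω)) μ := by
  have h : IndepFun (fun ω => ‖S ω‖ ^ 2 • S ω) x μ :=
    hind.comp (φ := fun s : E => ‖s‖ ^ 2 • s) (ψ := id) (by fun_prop) measurable_id
  exact h.integrable_bilin (integrable_sq_norm_smul_of_memLp_four hS)
    (hx.integrable (by norm_num)) (innerSL ℝ)

variable [CompleteSpace E]

theorem integral_inner_sq_norm_smul {S x : Ω → E} (hS : MemLp S 4 μ) (hx : MemLp x 4 μ)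
    (hind : IndepFun S x μ) (h0 : ∫ ω, x ω ∂μ = 0) :
    ∫ ω, inner ℝ (‖S ω‖ ^ 2 • S ω) (x ω) ∂μ = 0 := by
  have h : IndepFun (fun ω => ‖S ω‖ ^ 2 • S ω) x μ :=
    hind.comp (φ := fun s : E => ‖s‖ ^ 2 • s) (ψ := id) (by fun_prop) measurable_id
  have := h.integral_bilin (integrable_sq_norm_smul_of_memLp_four hS)
    (hx.integrable (by norm_num)) (innerSL ℝ)
  rw [h0] at this
  exact this.trans (map_zero _)

theorem integral_inner_of_indepFun {S x : Ω → E} (hS : MemLp S 4 μ) (hx : MemLp x 4 μ)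
    (hind : IndepFun S x μ) (h0 : ∫ ω, x ω ∂μ = 0) :
    Integrable (fun ω => inner ℝ (S ω) (x ω)) μ ∧ ∫ ω, inner ℝ (S ω) (x ω) ∂μ = 0 := by
  have hSi := hS.integrable (by norm_num)
  have hxi := hx.integrable (by norm_num)
  refine ⟨hind.integrable_bilin hSi hxi (innerSL ℝ), ?_⟩
  have := hind.integral_bilin hSi hxi (innerSL ℝ)
  rw [h0] at this
  exact this.trans (map_zero _)

variable [SecondCountableTopology E] {ξ : ℕ → Ω → E}

theorem integral_norm_sum_sq_le (hind : iIndepFun ξ μ) (hmeas : ∀ i, Measurable (ξ i))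
    (hξ4 : ∀ i, MemLp (ξ i) 4 μ) (h0 : ∀ i, ∫ ω, ξ i ω ∂μ = 0) {m : ℝ}
    (hm : ∀ i, ∫ ω, ‖ξ i ω‖ ^ 2 ∂μ ≤ m) (n : ℕ) :
    ∫ ω, ‖∑ i ∈ Finset.range n, ξ i ω‖ ^ 2 ∂μ ≤ n * m := by
  induction n with
  | zero => simp
  | succ n ih =>
    obtain ⟨hi, hi0⟩ := integral_inner_of_indepFun (memLp_sum_range hξ4 n) (hξ4 n)
      (indepFun_sum_range hind hmeas n) (h0 n)
    have hS := integrable_norm_pow_of_memLp_four (memLp_sum_range hξ4 n) (p := 2) (by norm_num)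
    have hx := integrable_norm_pow_of_memLp_four (hξ4 n) (p := 2) (by norm_num)
    simp_rw [Finset.sum_range_succ, norm_add_sq_real]
    have hA : Integrable (fun ω => ‖∑ i ∈ Finset.range n, ξ i ω‖ ^ 2 +
      2 * inner ℝ (∑ i ∈ Finset.range n, ξ i ω) (ξ n ω)) μ := hS.add (hi.const_mul 2)
    rw [integral_add hA hx, integral_add hS (hi.const_mul 2),
      integral_const_mul, hi0]
    push_cast
    linarith [hm n]

/-- Induction on `n`: one step adds at most `8 n m² + 3 M`, which fits below `4 (m² + M)(2n + 1)`.
-/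
theorem integral_norm_sum_pow_four_le (hind : iIndepFun ξ μ) (hmeas : ∀ i, Measurable (ξ i))
    (hξ4 : ∀ i, MemLp (ξ i) 4 μ) (h0 : ∀ i, ∫ ω, ξ i ω ∂μ = 0) {m M : ℝ}
    (hm : ∀ i, ∫ ω, ‖ξ i ω‖ ^ 2 ∂μ ≤ m) (hM : ∀ i, ∫ ω, ‖ξ i ω‖ ^ 4 ∂μ ≤ M) (n : ℕ) :
    ∫ ω, ‖∑ i ∈ Finset.range n, ξ i ω‖ ^ 4 ∂μ ≤ 4 * (m ^ 2 + M) * n ^ 2 := by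
  induction n with
  | zero => simp
  | succ n ih =>
    have hSL := memLp_sum_range hξ4 n
    have hSx := indepFun_sum_range hind hmeas n
    have hi := integrable_inner_sq_norm_smul hSL (hξ4 n) hSx
    have hi0 := integral_inner_sq_norm_smul hSL (hξ4 n) hSx (h0 n)
    have hS2 := integrable_norm_pow_of_memLp_four hSL (p := 2) (by norm_num)
    have hS4 := integrable_norm_pow_of_memLp_four hSL (p := 4) (by norm_num)
    have hx2 := integrable_norm_pow_of_memLp_four (hξ4 n) (p := 2) (by norm_num)
    have hx4 := integrable_norm_pow_of_memLp_four (hξ4 n) (p := 4) (by norm_num)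
    have hSx2 : IndepFun (fun ω => ‖∑ i ∈ Finset.range n, ξ i ω‖ ^ 2) (fun ω => ‖ξ n ω‖ ^ 2) μ :=
      hSx.comp (φ := fun s : E => ‖s‖ ^ 2) (ψ := fun s : E => ‖s‖ ^ 2) (by fun_prop) (by fun_prop)
    have hprod : Integrable
        (fun ω => ‖∑ i ∈ Finset.range n, ξ i ω‖ ^ 2 * ‖ξ n ω‖ ^ 2) μ :=
      hSx2.integrable_mul hS2 hx2
    have hprodI : ∫ ω, ‖∑ i ∈ Finset.range n, ξ i ω‖ ^ 2 * ‖ξ n ω‖ ^ 2 ∂μ ≤ n * m ^ 2 := by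
      rw [hSx2.integral_fun_mul_eq_mul_integral hS2.1 hx2.1]
      have h1 := integral_norm_sum_sq_le hind hmeas hξ4 h0 hm n
      have h2 : 0 ≤ ∫ ω, ‖ξ n ω‖ ^ 2 ∂μ := integral_nonneg fun ω => by positivity
      calc _ ≤ (n * m) * m := mul_le_mul h1 (hm n) h2 (by
            have := h2.trans (hm n); positivity)
        _ = _ := by ring
    have hM0 : 0 ≤ M := (integral_nonneg fun ω => by positivity).trans (hM n)
    simp_rw [Finset.sum_range_succ]
    have hle : ∫ ω, ‖∑ i ∈ Finset.range n, ξ i ω + ξ n ω‖ ^ 4 ∂μ ≤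
        ∫ ω, (‖∑ i ∈ Finset.range n, ξ i ω‖ ^ 4 +
          4 * inner ℝ (‖∑ i ∈ Finset.range n, ξ i ω‖ ^ 2 • ∑ i ∈ Finset.range n, ξ i ω) (ξ n ω) +
          8 * (‖∑ i ∈ Finset.range n, ξ i ω‖ ^ 2 * ‖ξ n ω‖ ^ 2) + 3 * ‖ξ n ω‖ ^ 4) ∂μ :=
      integral_mono
        (integrable_norm_pow_of_memLp_four (hSL.add (hξ4 n)) le_rfl)
        (((hS4.add (hi.const_mul 4)).add (hprod.const_mul 8)).add (hx4.const_mul 3))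
        fun ω => norm_add_pow_four_le _ _
    have hA : Integrable (fun ω => ‖∑ i ∈ Finset.range n, ξ i ω‖ ^ 4 +
      4 * inner ℝ (‖∑ i ∈ Finset.range n, ξ i ω‖ ^ 2 • ∑ i ∈ Finset.range n, ξ i ω)
        (ξ n ω)) μ := hS4.add (hi.const_mul 4)
    have hB : Integrable (fun ω => ‖∑ i ∈ Finset.range n, ξ i ω‖ ^ 4 +
      4 * inner ℝ (‖∑ i ∈ Finset.range n, ξ i ω‖ ^ 2 • ∑ i ∈ Finset.range n, ξ i ω) (ξ n ω) +
      8 * (‖∑ i ∈ Finset.range n, ξ i ω‖ ^ 2 * ‖ξ n ω‖ ^ 2)) μ := hA.add (hprod.const_mul 8)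
    rw [integral_add hB (hx4.const_mul 3), integral_add hA (hprod.const_mul 8),
      integral_add hS4 (hi.const_mul 4), integral_const_mul, integral_const_mul,
      integral_const_mul, hi0] at hle
    push_cast
    have := hM n
    have hn : (0 : ℝ) ≤ n := n.cast_nonneg
    nlinarith [mul_nonneg hn hM0, sq_nonneg m]

/-- In the subgradient inequality the linear term has zero conditional expectation: its left factor
is measurable with respect to the past and the next increment is independent of it and centred. -/
theorem submartingale_norm_sum_pow_four (hind : iIndepFun ξ μ) (hmeas : ∀ i, Measurable (ξ i))
    (hξ4 : ∀ i, MemLp (ξ i) 4 μ) (h0 : ∀ i, ∫ ω, ξ i ω ∂μ = 0) :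
    Submartingale (fun n ω => ‖∑ i ∈ Finset.range (n + 1), ξ i ω‖ ^ 4)
      (Filtration.natural ξ fun i => (hmeas i).stronglyMeasurable) μ := by
  set 𝒢 := Filtration.natural ξ fun i => (hmeas i).stronglyMeasurable with h𝒢
  have hadS : ∀ n, StronglyMeasurable[𝒢 n] fun ω => ∑ i ∈ Finset.range (n + 1), ξ i ω := by
    intro n
    refine Finset.stronglyMeasurable_fun_sum _ fun i hi => ?_
    exact (Filtration.stronglyAdapted_natural (fun i => (hmeas i).stronglyMeasurable) i).mono
      (𝒢.mono (Finset.mem_range_succ_iff.1 hi))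
  have hS4 := fun n => integrable_norm_pow_of_memLp_four (memLp_sum_range hξ4 (n + 1)) le_rfl
  refine submartingale_nat (fun n => (hadS n).norm.pow 4) hS4 fun n => ?_
  have hSL := memLp_sum_range hξ4 (n + 1)
  have hSx := indepFun_sum_range hind hmeas (n + 1)
  have hi := integrable_inner_sq_norm_smul hSL (hξ4 (n + 1)) hSx
  have hpull := condExp_bilin_of_stronglyMeasurable_left (μ := μ) (m := 𝒢 n) (innerSL ℝ)
    (((hadS n).norm.pow 2).smul (hadS n)) hi ((hξ4 (n + 1)).integrable (by norm_num))
  have hzero := hind.condExp_natural_ae_eq_of_lt (fun i => (hmeas i).stronglyMeasurable)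
    (Nat.lt_succ_self n)
  have hmono := condExp_mono (m := 𝒢 n) ((hS4 n).add (hi.const_mul 4)) (hS4 (n + 1))
    (Eventually.of_forall fun ω => by
      simp only [Pi.add_apply]
      rw [Finset.sum_range_succ _ (n + 1)]
      exact le_norm_add_pow_four _ _)
  have hadd := condExp_add (hS4 n) (hi.const_mul 4) (𝒢 n)
  have hsmul := condExp_smul (μ := μ) (4 : ℝ) (fun ω => inner ℝ
    (‖∑ i ∈ Finset.range (n + 1), ξ i ω‖ ^ 2 • ∑ i ∈ Finset.range (n + 1), ξ i ω)
    (ξ (n + 1) ω)) (𝒢 n)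
  have hself := condExp_of_stronglyMeasurable (𝒢.le n) ((hadS n).norm.pow 4) (hS4 n)
  filter_upwards [hpull, hzero, hmono, hadd, hsmul] with ω h1 h2 h3 h4 h5
  refine le_trans ?_ h3
  refine le_of_eq ?_
  refine Eq.trans ?_ h4.symm
  rw [Pi.add_apply]
  have h6 : μ[fun ω => ‖∑ i ∈ Finset.range (n + 1), ξ i ω‖ ^ 4 | 𝒢 n] ω =
    ‖∑ i ∈ Finset.range (n + 1), ξ i ω‖ ^ 4 := congrFun hself ω
  have h7 : μ[fun ω => 4 * inner ℝ
    (‖∑ i ∈ Finset.range (n + 1), ξ i ω‖ ^ 2 • ∑ i ∈ Finset.range (n + 1), ξ i ω)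
    (ξ (n + 1) ω) | 𝒢 n] ω = 0 := by
    refine Eq.trans h5 ?_
    rw [Pi.smul_apply]
    refine (congrArg (fun t => (4 : ℝ) • t) h1).trans ?_
    rw [h𝒢, h2, h0]
    simp
  rw [h6, h7, add_zero]

theorem measure_max_norm_sum_pow_four_le (hind : iIndepFun ξ μ) (hmeas : ∀ i, Measurable (ξ i))
    (hξ4 : ∀ i, MemLp (ξ i) 4 μ) (h0 : ∀ i, ∫ ω, ξ i ω ∂μ = 0) {m M : ℝ}
    (hm : ∀ i, ∫ ω, ‖ξ i ω‖ ^ 2 ∂μ ≤ m) (hM : ∀ i, ∫ ω, ‖ξ i ω‖ ^ 4 ∂μ ≤ M) (N : ℕ) {η : ℝ}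
    (hη : 0 < η) :
    μ {ω | ∃ k, 1 ≤ k ∧ k ≤ N + 1 ∧ η ≤ ‖∑ i ∈ Finset.range k, ξ i ω‖ ^ 4} ≤
      ENNReal.ofReal (4 * (m ^ 2 + M) * (N + 1 : ℕ) ^ 2 / η) := by
  have hsub := submartingale_norm_sum_pow_four hind hmeas hξ4 h0
  have h := maximal_ineq hsub (fun n ω => by simp only [Pi.zero_apply]; positivity)
    (ε := NNReal.mk η hη.le) N
  have hint := integrable_norm_pow_of_memLp_four (memLp_sum_range hξ4 (N + 1)) le_rfl
  have h2 : ENNReal.ofReal (∫ ω in {ω | ((NNReal.mk η hη.le) : ℝ) ≤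
      (Finset.range (N + 1)).sup' Finset.nonempty_range_add_one
        fun k => ‖∑ i ∈ Finset.range (k + 1), ξ i ω‖ ^ 4},
      ‖∑ i ∈ Finset.range (N + 1), ξ i ω‖ ^ 4 ∂μ) ≤
      ENNReal.ofReal (4 * (m ^ 2 + M) * (N + 1 : ℕ) ^ 2) := by
    refine ENNReal.ofReal_le_ofReal (le_trans ?_
      (integral_norm_sum_pow_four_le hind hmeas hξ4 h0 hm hM (N + 1)))
    exact setIntegral_le_integral hint (Eventually.of_forall fun ω => by
      simp only [Pi.zero_apply]; positivity)
  have h3 := h.trans h2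
  rw [ENNReal.ofReal_div_of_pos hη, ENNReal.le_div_iff_mul_le (by simp [hη]) (by simp), mul_comm]
  refine le_trans ?_ h3
  rw [show ENNReal.ofReal η = ((NNReal.mk η hη.le) : ℝ≥0∞) by
    rw [ENNReal.ofReal, Real.toNNReal_of_nonneg hη.le]]
  refine mul_le_mul_right (measure_mono ?_) _
  rintro ω ⟨k, hk1, hkN, hk⟩
  refine hk.trans ?_
  obtain ⟨j, rfl⟩ := Nat.exists_eq_add_of_le' hk1
  exact Finset.le_sup' (fun k => ‖∑ i ∈ Finset.range (k + 1), ξ i ω‖ ^ 4)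
    (Finset.mem_range.2 (by omega))

end RandomWalk

/-! ### Almost sure growth of the walk -/

section RandomWalk

variable {Ω E : Type*} [MeasurableSpace Ω] {μ : Measure Ω} [IsProbabilityMeasure μ]
  [NormedAddCommGroup E] [InnerProductSpace ℝ E] [CompleteSpace E] [MeasurableSpace E]
  [BorelSpace E] [SecondCountableTopology E] {ξ : ℕ → Ω → E}

theorem ae_eventually_norm_sum_pow_four_lt (hind : iIndepFun ξ μ) (hmeas : ∀ i, Measurable (ξ i))
    (hξ4 : ∀ i, MemLp (ξ i) 4 μ) (h0 : ∀ i, ∫ ω, ξ i ω ∂μ = 0) {m M : ℝ}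
    (hm : ∀ i, ∫ ω, ‖ξ i ω‖ ^ 2 ∂μ ≤ m) (hM : ∀ i, ∫ ω, ‖ξ i ω‖ ^ 4 ∂μ ≤ M) :
    ∀ᵐ ω ∂μ, ∀ᶠ j : ℕ in atTop, ∀ k, 1 ≤ k → k ≤ 2 ^ (j + 1) →
      ‖∑ i ∈ Finset.range k, ξ i ω‖ ^ 4 < 4 ^ j * ((j : ℝ) + 1) ^ (3 / 2 : ℝ) := by
  have hηpos : ∀ j : ℕ, (0 : ℝ) < 4 ^ j * ((j : ℝ) + 1) ^ (3 / 2 : ℝ) := fun j => by positivity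
  -- The exponent 3/2 exceeds 1, which makes the probabilities summable, and is below 2, which makes
  -- the threshold negligible against `(n log n)²` for `n` near `2 ^ j`.
  set A : ℕ → Set Ω := fun j => {ω | ∃ k, 1 ≤ k ∧ k ≤ 2 ^ (j + 1) ∧
    4 ^ j * ((j : ℝ) + 1) ^ (3 / 2 : ℝ) ≤ ‖∑ i ∈ Finset.range k, ξ i ω‖ ^ 4} with hA
  have hbound : ∀ j, μ (A j) ≤
      ENNReal.ofReal (16 * (m ^ 2 + M) * (1 / ((j : ℝ) + 1) ^ (3 / 2 : ℝ))) := by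
    intro j
    have h := measure_max_norm_sum_pow_four_le hind hmeas hξ4 h0 hm hM (2 ^ (j + 1) - 1) (hηpos j)
    rw [Nat.sub_add_cancel Nat.one_le_two_pow] at h
    refine h.trans_eq (congrArg ENNReal.ofReal ?_)
    have h4 : ((2 ^ (j + 1) : ℕ) : ℝ) ^ 2 = 4 * 4 ^ j := by
      push_cast
      rw [← pow_mul, mul_comm, pow_mul, pow_succ]; norm_num; ring
    rw [h4]
    field_simp
    ring
  have hsum : Summable fun j : ℕ => 16 * (m ^ 2 + M) * (1 / ((j : ℝ) + 1) ^ (3 / 2 : ℝ)) := by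
    refine Summable.mul_left _ ?_
    have := (summable_nat_add_iff (f := fun n : ℕ => 1 / (n : ℝ) ^ (3 / 2 : ℝ)) 1).2
      (Real.summable_one_div_nat_rpow.2 (by norm_num))
    simpa using this
  have hfin : ∑' j, μ (A j) ≠ ∞ :=
    ne_top_of_le_ne_top hsum.tsum_ofReal_ne_top (ENNReal.tsum_le_tsum hbound)
  filter_upwards [ae_eventually_notMem hfin] with ω hω
  filter_upwards [hω] with j hj k hk1 hk2
  by_contra! hcon
  exact hj ⟨k, hk1, hk2, hcon⟩

/-- A Hilbert-valued random walk with centred increments bounded in `L⁴` is `o(√(n log n))`. -/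
theorem ae_tendsto_norm_sum_pow_four_div (hind : iIndepFun ξ μ) (hmeas : ∀ i, Measurable (ξ i))
    (hξ4 : ∀ i, MemLp (ξ i) 4 μ) (h0 : ∀ i, ∫ ω, ξ i ω ∂μ = 0) {m M : ℝ}
    (hm : ∀ i, ∫ ω, ‖ξ i ω‖ ^ 2 ∂μ ≤ m) (hM : ∀ i, ∫ ω, ‖ξ i ω‖ ^ 4 ∂μ ≤ M) :
    ∀ᵐ ω ∂μ, Tendsto (fun n : ℕ => ‖∑ i ∈ Finset.range n, ξ i ω‖ ^ 4 / (n * Real.log n) ^ 2)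
      atTop (𝓝 0) := by
  filter_upwards [ae_eventually_norm_sum_pow_four_lt hind hmeas hξ4 h0 hm hM] with ω hω
  have hlog : Tendsto (fun n : ℕ => Nat.log 2 n) atTop atTop := by
    refine tendsto_atTop.2 fun b => ?_
    filter_upwards [eventually_ge_atTop (2 ^ b)] with n hn
    exact Nat.le_log_of_pow_le (by norm_num) hn
  -- The exponent is 3/2 - 2, and 16 = 4² comes from the bound `(j + 1) / 4 ≤ log n` below.
  have hlim : Tendsto (fun n : ℕ => 16 * (((Nat.log 2 n : ℕ) : ℝ) + 1) ^ (-(1 / 2) : ℝ))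
      atTop (𝓝 0) := by
    have h1 : Tendsto (fun n : ℕ => ((Nat.log 2 n : ℕ) : ℝ) + 1) atTop atTop :=
      tendsto_atTop_add_const_right _ _ (tendsto_natCast_atTop_atTop.comp hlog)
    simpa using ((tendsto_rpow_neg_atTop (by norm_num : (0 : ℝ) < 1 / 2)).comp h1).const_mul 16
  refine squeeze_zero' (Eventually.of_forall fun n => by positivity) ?_ hlim
  filter_upwards [hlog.eventually hω, hlog.eventually (eventually_ge_atTop 1),
    eventually_ge_atTop 1] with n hn hj hn1
  set j := Nat.log 2 n with hjdef
  have hlo : 2 ^ j ≤ n := Nat.pow_log_le_self 2 (by omega)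
  have hhi : n ≤ 2 ^ (j + 1) := (Nat.lt_pow_succ_log_self (by norm_num) n).le
  have hS := hn n hn1 hhi
  have hn0 : (0 : ℝ) < n := by exact_mod_cast hn1
  have hlo' : (2 : ℝ) ^ j ≤ n := by exact_mod_cast hlo
  have hj1 : (1 : ℝ) ≤ j := by exact_mod_cast hj
  have hlogn : ((j : ℝ) + 1) / 4 ≤ Real.log n := by
    have h1 : (j : ℝ) * Real.log 2 ≤ Real.log n := by
      rw [← Real.log_pow]
      exact Real.log_le_log (by positivity) hlo'
    have h2 := Real.log_two_gt_d9
    nlinarith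
  have h4 : (4 : ℝ) ^ j ≤ n ^ 2 := by
    have : (4 : ℝ) ^ j = (2 ^ j) ^ 2 := by rw [← pow_mul, mul_comm, pow_mul]; norm_num
    rw [this]
    gcongr
  have hlpos : 0 < Real.log n := lt_of_lt_of_le (by positivity) hlogn
  rw [div_le_iff₀ (by positivity)]
  have hr : ((j : ℝ) + 1) ^ (3 / 2 : ℝ) = ((j : ℝ) + 1) ^ (-(1 / 2) : ℝ) * ((j : ℝ) + 1) ^ 2 := by
    rw [← Real.rpow_natCast, ← Real.rpow_add (by positivity)]
    norm_num
  calc ‖∑ i ∈ Finset.range n, ξ i ω‖ ^ 4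
      ≤ 4 ^ j * ((j : ℝ) + 1) ^ (3 / 2 : ℝ) := hS.le
    _ ≤ n ^ 2 * ((j : ℝ) + 1) ^ (3 / 2 : ℝ) := by gcongr
    _ = 16 * ((j : ℝ) + 1) ^ (-(1 / 2) : ℝ) * (n * (((j : ℝ) + 1) / 4)) ^ 2 := by rw [hr]; ring
    _ ≤ 16 * ((j : ℝ) + 1) ^ (-(1 / 2) : ℝ) * (n * Real.log n) ^ 2 := by gcongr

/-- The rate hypothesis gives `n log n ≤ (n lam n)²`, so the preceding growth bound controls the
fourth power of the ratio. The exceptional null set does not depend on `lam`. -/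
theorem ae_tendsto_norm_mean_div (hind : iIndepFun ξ μ) (hmeas : ∀ i, Measurable (ξ i))
    (hξ4 : ∀ i, MemLp (ξ i) 4 μ) (h0 : ∀ i, ∫ ω, ξ i ω ∂μ = 0) {m M : ℝ}
    (hm : ∀ i, ∫ ω, ‖ξ i ω‖ ^ 2 ∂μ ≤ m) (hM : ∀ i, ∫ ω, ‖ξ i ω‖ ^ 4 ∂μ ≤ M) :
    ∀ᵐ ω ∂μ, ∀ lam : ℕ → ℝ, (∀ᶠ n in atTop, 0 < lam n) →
      (∀ᶠ n : ℕ in atTop, 2 * Real.log n ≤ n * lam n ^ 2) →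
      Tendsto (fun n : ℕ => ‖(n : ℝ)⁻¹ • ∑ i ∈ Finset.range n, ξ i ω‖ / lam n) atTop (𝓝 0) := by
  filter_upwards [ae_tendsto_norm_sum_pow_four_div hind hmeas hξ4 h0 hm hM] with ω hω lam hlam hn
  have h4 : Tendsto (fun n : ℕ => (‖(n : ℝ)⁻¹ • ∑ i ∈ Finset.range n, ξ i ω‖ / lam n) ^ 4)
      atTop (𝓝 0) := by
    refine squeeze_zero' (Eventually.of_forall fun n => by positivity) ?_ hω
    filter_upwards [hlam, hn, eventually_ge_atTop 2] with n hl h2 hn2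
    have hn2' : (2 : ℝ) ≤ n := by exact_mod_cast hn2
    have hlog : 0 < Real.log n := Real.log_pos (by linarith)
    rw [norm_smul, norm_inv, Real.norm_natCast, inv_mul_eq_div, div_div, div_pow]
    refine div_le_div_of_nonneg_left (by positivity) (by positivity) ?_
    have h3 : n * Real.log n ≤ (n * lam n) ^ 2 := by nlinarith
    calc (n * Real.log n) ^ 2 ≤ ((n * lam n) ^ 2) ^ 2 := by gcongr
      _ = _ := by ring
  have h5 := ((Real.continuous_sqrt.comp Real.continuous_sqrt).tendsto 0).comp h4
  simp only [Function.comp_def, Real.sqrt_zero] at h5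
  refine h5.congr' ?_
  filter_upwards [hlam] with n hl
  rw [show ∀ t : ℝ, t ^ 4 = (t ^ 2) ^ 2 by intro t; ring, Real.sqrt_sq (by positivity),
    Real.sqrt_sq (by positivity)]

end RandomWalk

/-! ### The synthesis operator and separability of ℓ₂ -/

section Synthesis

variable {Γ 𝓨 : Type*} [NormedAddCommGroup 𝓨] [InnerProductSpace ℝ 𝓨]

theorem hasSum_sq_norm {G : Type*} [NormedAddCommGroup G] (a : lp (fun _ : Γ => G) 2) :
    HasSum (fun γ => ‖a γ‖ ^ 2) (‖a‖ ^ 2) := by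
  have := lp.hasSum_norm (by norm_num : 0 < (2 : ℝ≥0∞).toReal) a
  simpa using this

theorem summable_norm_smul (a : lp (fun _ : Γ => 𝓨) 2) (β : Ell2 Γ) :
    Summable fun γ => ‖β γ • a γ‖ := by
  refine Summable.of_nonneg_of_le (fun _ => norm_nonneg _) (fun γ => ?_)
    ((hasSum_sq_norm β).summable.add (hasSum_sq_norm a).summable)
  rw [norm_smul]
  nlinarith [sq_nonneg (‖β γ‖ - ‖a γ‖), sq_nonneg (‖β γ‖ + ‖a γ‖)]

theorem norm_tsum_smul_le (a : lp (fun _ : Γ => 𝓨) 2) (β : Ell2 Γ) :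
    ‖∑' γ, β γ • a γ‖ ≤ ‖a‖ * ‖β‖ := by
  refine (norm_tsum_le_tsum_norm (summable_norm_smul a β)).trans ?_
  simp_rw [norm_smul, mul_comm ‖a‖]
  refine Real.tsum_le_of_sum_le (fun _ => by positivity) fun s => ?_
  refine (Real.sum_mul_le_sqrt_mul_sqrt s _ _).trans ?_
  gcongr
  · exact Real.sqrt_le_iff.2 ⟨norm_nonneg _, sum_le_hasSum s (fun _ _ => by positivity)
      (hasSum_sq_norm β)⟩
  · exact Real.sqrt_le_iff.2 ⟨norm_nonneg _, sum_le_hasSum s (fun _ _ => by positivity)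
      (hasSum_sq_norm a)⟩

variable [CompleteSpace 𝓨]

/-- The bilinear map `(a, β) ↦ ∑_γ β_γ a_γ`. -/
noncomputable def synthesis : lp (fun _ : Γ => 𝓨) 2 →L[ℝ] Ell2 Γ →L[ℝ] 𝓨 :=
  LinearMap.mkContinuous₂ (LinearMap.mk₂ ℝ (fun a β => ∑' γ, β γ • a γ)
    (fun a b β => by
      rw [← (summable_norm_smul a β).of_norm.tsum_add (summable_norm_smul b β).of_norm]
      simp)
    (fun c a β => by
      rw [← (summable_norm_smul a β).of_norm.tsum_const_smul c]
      exact tsum_congr fun γ => smul_comm _ _ _)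
    (fun a β β' => by
      rw [← (summable_norm_smul a β).of_norm.tsum_add (summable_norm_smul a β').of_norm]
      simp [add_smul])
    (fun c a β => by
      rw [← (summable_norm_smul a β).of_norm.tsum_const_smul c]
      simp [mul_smul])) 1
    (fun a β => by
      rw [one_mul]
      exact norm_tsum_smul_le a β)

theorem norm_synthesis_le (a : lp (fun _ : Γ => 𝓨) 2) : ‖synthesis a‖ ≤ ‖a‖ :=
  ContinuousLinearMap.opNorm_le_bound _ (norm_nonneg _) (norm_tsum_smul_le a)

end Synthesis

instance secondCountableTopology_ell2 {Γ : Type*} [Countable Γ] :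
    SecondCountableTopology (Ell2 Γ) := by
  classical
  have : TopologicalSpace.SeparableSpace (Ell2 Γ) := by
    have h1 : (Set.range fun γ : Γ => (lp.single 2 γ (1 : ℝ) : Ell2 Γ)).Countable :=
      Set.countable_range _
    have h2 := (h1.isSeparable.span (R := ℝ)).closure
    rw [← TopologicalSpace.isSeparable_univ_iff]
    refine h2.mono fun β _ => ?_
    refine mem_closure_of_tendsto (lp.hasSum_single (by norm_num) β)
      (Eventually.of_forall fun s => ?_)
    refine Submodule.sum_mem _ fun γ _ => ?_
    have : lp.single 2 γ (β γ) = β γ • (lp.single 2 γ (1 : ℝ) : Ell2 Γ) := by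
      rw [← lp.single_smul]; simp
    rw [this]
    exact Submodule.smul_mem _ _ (Submodule.subset_span ⟨γ, rfl⟩)
  exact UniformSpace.secondCountable_of_separable _

/-! ### The feature operators and their measurability -/

section FeatureMap

variable {Γ 𝓧 𝓨 : Type*} [MeasurableSpace 𝓧] [NormedAddCommGroup 𝓨]
  [MeasurableSpace 𝓨] {φ : Γ → 𝓧 → 𝓨} {κ : ℝ}

/-- The family `(φ_γ(x))_γ` as an element of `ℓ₂(Γ, 𝓨)`. -/
def BoundedFeatures.seq (hφ : BoundedFeatures φ κ) (x : 𝓧) : lp (fun _ : Γ => 𝓨) 2 :=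
  ⟨fun γ => φ γ x, memℓp_gen (by simpa using hφ.summable x)⟩

theorem BoundedFeatures.sq_norm_seq_le (hφ : BoundedFeatures φ κ) (x : 𝓧) :
    ‖hφ.seq x‖ ^ 2 ≤ κ :=
  (hasSum_sq_norm (hφ.seq x)).tsum_eq ▸ hφ.bound x

variable [InnerProductSpace ℝ 𝓨] [CompleteSpace 𝓨]

/-- The operator `β ↦ f_β(x)`. -/
noncomputable def BoundedFeatures.op (hφ : BoundedFeatures φ κ) (x : 𝓧) : Ell2 Γ →L[ℝ] 𝓨 :=
  synthesis (hφ.seq x)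

theorem BoundedFeatures.op_apply (hφ : BoundedFeatures φ κ) (x : 𝓧) (β : Ell2 Γ) :
    hφ.op x β = predictor φ β x := rfl

theorem BoundedFeatures.norm_op_le (hφ : BoundedFeatures φ κ) (x : 𝓧) : ‖hφ.op x‖ ≤ √κ :=
  (norm_synthesis_le _).trans (Real.le_sqrt_of_sq_le (hφ.sq_norm_seq_le x))

/-- A space of operators need not be separable, so strong measurability is obtained upstream:
`hφ.seq` is a pointwise limit of finite sums of coordinate embeddings, and `synthesis` is continuous
into the operator norm. -/
theorem BoundedFeatures.stronglyMeasurable_op [Countable Γ] [BorelSpace 𝓨]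
    [SecondCountableTopology 𝓨] (hφ : BoundedFeatures φ κ) : StronglyMeasurable hφ.op := by
  classical
  have h : StronglyMeasurable hφ.seq := by
    refine stronglyMeasurable_of_tendsto (u := atTop)
      (f := fun s : Finset Γ => fun x => ∑ γ ∈ s, lp.single 2 γ (φ γ x))
      (fun s => Finset.stronglyMeasurable_fun_sum _ fun γ _ => ?_) ?_
    · exact (lp.isometry_single γ).continuous.comp_stronglyMeasurable
        (hφ.measurable γ).stronglyMeasurable
    · exact tendsto_pi_nhds.2 fun x => lp.hasSum_single (by norm_num) (hφ.seq x)
  exact synthesis.continuous.comp_stronglyMeasurable h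

end FeatureMap

theorem two_mul_ofReal_add_le {r s t t' : ℝ} (hr : 0 ≤ r) (hs : 0 ≤ s) (ht : 0 ≤ t) (ht' : 0 ≤ t')
    (h : 2 * r + s ≤ t + t') :
    2 * ENNReal.ofReal r + ENNReal.ofReal s ≤ ENNReal.ofReal t + ENNReal.ofReal t' := by
  rw [← ENNReal.ofReal_add ht ht', two_mul, ← ENNReal.ofReal_add hr hr, ← two_mul,
    ← ENNReal.ofReal_add (by positivity) hs]
  exact ENNReal.ofReal_le_ofReal h

/-! ### Semicontinuity, coercivity and strong convexity of the penalty -/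

section Penalty

variable {Γ : Type*} {w : Γ → ℝ} {ε : ℝ}

theorem lowerSemicontinuous_penalty : LowerSemicontinuous (penalty w ε) := by
  refine lowerSemicontinuous_tsum fun γ => Continuous.lowerSemicontinuous ?_
  have h : Continuous fun β : Ell2 Γ => β γ := (lp.lipschitzWith_one_eval 2 γ).continuous
  exact ENNReal.continuous_ofReal.comp
    ((continuous_const.mul h.abs).add (continuous_const.mul (h.pow 2)))

theorem penalty_term_nonneg (hw : ∀ γ, 0 ≤ w γ) (hε : 0 ≤ ε) (β : Ell2 Γ) (γ : Γ) :
    0 ≤ w γ * |β γ| + ε * β γ ^ 2 :=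
  add_nonneg (mul_nonneg (hw γ) (abs_nonneg _)) (by positivity)

theorem ofReal_mul_sq_norm (hε : 0 ≤ ε) (β : Ell2 Γ) :
    ENNReal.ofReal (ε * ‖β‖ ^ 2) = ∑' γ, ENNReal.ofReal (ε * β γ ^ 2) := by
  have h : HasSum (fun γ => ε * β γ ^ 2) (ε * ‖β‖ ^ 2) := by
    simpa using (hasSum_sq_norm β).mul_left ε
  rw [← h.tsum_eq, ENNReal.ofReal_tsum_of_nonneg (fun γ => by positivity) h.summable]

theorem ofReal_mul_sq_norm_le_penalty (hw : ∀ γ, 0 ≤ w γ) (hε : 0 ≤ ε) (β : Ell2 Γ) :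
    ENNReal.ofReal (ε * ‖β‖ ^ 2) ≤ penalty w ε β := by
  rw [ofReal_mul_sq_norm hε]
  refine ENNReal.tsum_le_tsum fun γ => ENNReal.ofReal_le_ofReal ?_
  have := mul_nonneg (hw γ) (abs_nonneg (β γ))
  linarith

theorem penalty_ne_top {β : Ell2 Γ} (hβ : Summable fun γ => w γ * |β γ|) : penalty w ε β ≠ ∞ := by
  have h : Summable fun γ => ε * β γ ^ 2 := by
    simpa using (hasSum_sq_norm β).summable.mul_left ε
  exact (hβ.add h).tsum_ofReal_ne_top

theorem midpoint_apply (a b : Ell2 Γ) (γ : Γ) : (midpoint ℝ a b) γ = (a γ + b γ) / 2 := by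
  rw [midpoint_eq_smul_add, lp.coeFn_smul, Pi.smul_apply, lp.coeFn_add, Pi.add_apply, smul_eq_mul,
    invOf_eq_inv]
  ring

theorem midpointStronglyConvex_penalty (hw : ∀ γ, 0 ≤ w γ) (hε : 0 ≤ ε) :
    MidpointStronglyConvex (ε / 2) (penalty w ε) := by
  intro a b
  rw [ofReal_mul_sq_norm (by positivity)]
  unfold penalty
  rw [← ENNReal.tsum_mul_left, ← ENNReal.tsum_add, ← ENNReal.tsum_add]
  refine ENNReal.tsum_le_tsum fun γ => ?_
  refine two_mul_ofReal_add_le (penalty_term_nonneg hw hε _ _) (by positivity)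
    (penalty_term_nonneg hw hε _ _) (penalty_term_nonneg hw hε _ _) ?_
  rw [midpoint_apply, lp.coeFn_sub, Pi.sub_apply, abs_div, abs_two]
  nlinarith [mul_le_mul_of_nonneg_left (abs_add_le (a γ) (b γ)) (hw γ)]

end Penalty

/-! ### Quadratic expansion of the empirical risk and the basic inequality -/

section EmpiricalRisk

variable {Γ 𝓧 𝓨 : Type*} [NormedAddCommGroup 𝓨] [InnerProductSpace ℝ 𝓨]

/-- The empirical risk `(1/n) ∑_{i<n} ‖y_i - f_β(x_i)‖²`. -/
noncomputable def empiricalRisk (φ : Γ → 𝓧 → 𝓨) (n : ℕ) (x : ℕ → 𝓧) (y : ℕ → 𝓨) (β : Ell2 Γ) : ℝ :=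
  (1 / (n : ℝ)) * ∑ i ∈ Finset.range n, ‖y i - predictor φ β (x i)‖ ^ 2

theorem empiricalRisk_nonneg {φ : Γ → 𝓧 → 𝓨} (n : ℕ) (x : ℕ → 𝓧) (y : ℕ → 𝓨) (β : Ell2 Γ) :
    0 ≤ empiricalRisk φ n x y β :=
  mul_nonneg (by positivity) (Finset.sum_nonneg fun _ _ => by positivity)

variable [MeasurableSpace 𝓧] [CompleteSpace 𝓨] [MeasurableSpace 𝓨] {φ : Γ → 𝓧 → 𝓨} {κ : ℝ} {w : Γ → ℝ} {ε lam : ℝ}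

/-- The operator `Φ_x^* Φ_x` on `ℓ₂`. -/
noncomputable def BoundedFeatures.gram (hφ : BoundedFeatures φ κ) (x : 𝓧) :
    Ell2 Γ →L[ℝ] Ell2 Γ :=
  (ContinuousLinearMap.adjoint (hφ.op x)).comp (hφ.op x)

/-- The vector `Φ_x^* (y - Φ_x β)`. -/
noncomputable def BoundedFeatures.score (hφ : BoundedFeatures φ κ) (β : Ell2 Γ) (z : 𝓧 × 𝓨) :
    Ell2 Γ :=
  ContinuousLinearMap.adjoint (hφ.op z.1) (noise φ β z)

theorem BoundedFeatures.inner_gram (hφ : BoundedFeatures φ κ) (x : 𝓧) (u : Ell2 Γ) :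
    inner ℝ (hφ.gram x u) u = ‖predictor φ u x‖ ^ 2 := by
  rw [gram, ContinuousLinearMap.comp_apply, ContinuousLinearMap.adjoint_inner_left,
    real_inner_self_eq_norm_sq, op_apply]

theorem BoundedFeatures.inner_score (hφ : BoundedFeatures φ κ) (β : Ell2 Γ) (z : 𝓧 × 𝓨)
    (u : Ell2 Γ) : inner ℝ (hφ.score β z) u = inner ℝ (noise φ β z) (predictor φ u z.1) := by
  rw [score, ContinuousLinearMap.adjoint_inner_left, op_apply]

theorem BoundedFeatures.predictor_sub (hφ : BoundedFeatures φ κ) (a b : Ell2 Γ) (x : 𝓧) :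
    predictor φ (a - b) x = predictor φ a x - predictor φ b x := by
  simp only [← hφ.op_apply, map_sub]

/-- The mean of the operators `Φ_{x_i}^* Φ_{x_i}`, `i < n`. -/
noncomputable def BoundedFeatures.meanGram (hφ : BoundedFeatures φ κ) (x : ℕ → 𝓧) (n : ℕ) :
    Ell2 Γ →L[ℝ] Ell2 Γ :=
  (n : ℝ)⁻¹ • ∑ i ∈ Finset.range n, hφ.gram (x i)

/-- The mean of the vectors `Φ_{x_i}^* (y_i - Φ_{x_i} β)`, `i < n`. -/
noncomputable def BoundedFeatures.meanScore (hφ : BoundedFeatures φ κ) (β : Ell2 Γ) (x : ℕ → 𝓧)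
    (y : ℕ → 𝓨) (n : ℕ) : Ell2 Γ :=
  (n : ℝ)⁻¹ • ∑ i ∈ Finset.range n, hφ.score β (x i, y i)

theorem BoundedFeatures.inner_meanGram (hφ : BoundedFeatures φ κ) (x : ℕ → 𝓧) (n : ℕ)
    (u : Ell2 Γ) : inner ℝ (hφ.meanGram x n u) u =
      (1 / (n : ℝ)) * ∑ i ∈ Finset.range n, ‖predictor φ u (x i)‖ ^ 2 := by
  rw [meanGram, _root_.smul_apply, real_inner_smul_left,
    _root_.sum_apply, sum_inner, one_div]
  simp_rw [hφ.inner_gram]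

theorem BoundedFeatures.inner_meanGram_nonneg (hφ : BoundedFeatures φ κ) (x : ℕ → 𝓧) (n : ℕ)
    (u : Ell2 Γ) : 0 ≤ inner ℝ (hφ.meanGram x n u) u := by
  rw [hφ.inner_meanGram]
  exact mul_nonneg (by positivity) (Finset.sum_nonneg fun _ _ => by positivity)

theorem BoundedFeatures.empiricalRisk_eq (hφ : BoundedFeatures φ κ) (n : ℕ) (x : ℕ → 𝓧)
    (y : ℕ → 𝓨) (β β₀ : Ell2 Γ) :
    empiricalRisk φ n x y β = empiricalRisk φ n x y β₀ -
      2 * inner ℝ (hφ.meanScore β₀ x y n) (β - β₀) +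
      inner ℝ (hφ.meanGram x n (β - β₀)) (β - β₀) := by
  rw [hφ.inner_meanGram, meanScore, real_inner_smul_left, sum_inner, ← one_div]
  unfold empiricalRisk
  rw [← mul_assoc, mul_comm 2, mul_assoc, ← mul_sub, ← mul_add,
    Finset.mul_sum _ _ (2 : ℝ), ← Finset.sum_sub_distrib, ← Finset.sum_add_distrib]
  refine congrArg _ (Finset.sum_congr rfl fun i _ => ?_)
  rw [hφ.inner_score, noise, ← norm_sub_sq_real, hφ.predictor_sub]
  congr 2
  abel

theorem BoundedFeatures.continuous_empiricalRisk (hφ : BoundedFeatures φ κ) (n : ℕ) (x : ℕ → 𝓧)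
    (y : ℕ → 𝓨) : Continuous (empiricalRisk φ n x y) := by
  unfold empiricalRisk
  simp_rw [← hφ.op_apply]
  fun_prop

theorem BoundedFeatures.empiricalRisk_midpoint (hφ : BoundedFeatures φ κ) (n : ℕ) (x : ℕ → 𝓧)
    (y : ℕ → 𝓨) (a b : Ell2 Γ) :
    2 * empiricalRisk φ n x y (midpoint ℝ a b) + inner ℝ (hφ.meanGram x n (a - b)) (a - b) / 2 =
      empiricalRisk φ n x y a + empiricalRisk φ n x y b := by
  rw [hφ.empiricalRisk_eq n x y a (midpoint ℝ a b), hφ.empiricalRisk_eq n x y b (midpoint ℝ a b)]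
  have ha : a - midpoint ℝ a b = (1 / 2 : ℝ) • (a - b) := by
    rw [left_sub_midpoint, invOf_eq_inv, one_div]
  have hb : b - midpoint ℝ a b = (-(1 / 2) : ℝ) • (a - b) := by
    rw [right_sub_midpoint, invOf_eq_inv, one_div, neg_smul, ← smul_neg, neg_sub]
  rw [ha, hb, map_smul, map_smul]
  simp only [real_inner_smul_left, real_inner_smul_right]
  ring

/-- Two independent sources of convexity add up: the penalty gives `lam * ε / 2` and a lower bound
on the empirical Gram form gives `c / 2`. Either may vanish, which serves both cases of the theorem.
-/
theorem BoundedFeatures.midpointStronglyConvex_empiricalFunctional (hφ : BoundedFeatures φ κ)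
    (hw : ∀ γ, 0 ≤ w γ) (hε : 0 ≤ ε) (hlam : 0 ≤ lam) (n : ℕ) (x : ℕ → 𝓧) (y : ℕ → 𝓨) {c : ℝ}
    (hc : 0 ≤ c) (hlow : ∀ u, c * ‖u‖ ^ 2 ≤ inner ℝ (hφ.meanGram x n u) u) :
    MidpointStronglyConvex (lam * ε / 2 + c / 2) (empiricalFunctional φ w ε lam n x y) := by
  intro a b
  have hR : 2 * ENNReal.ofReal (empiricalRisk φ n x y (midpoint ℝ a b)) +
      ENNReal.ofReal (c / 2 * ‖a - b‖ ^ 2) ≤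
      ENNReal.ofReal (empiricalRisk φ n x y a) + ENNReal.ofReal (empiricalRisk φ n x y b) := by
    refine two_mul_ofReal_add_le (empiricalRisk_nonneg n x y _) (by positivity)
      (empiricalRisk_nonneg n x y a) (empiricalRisk_nonneg n x y b) ?_
    rw [← hφ.empiricalRisk_midpoint n x y a b]
    linarith [hlow (a - b)]
  have hp := mul_le_mul_right (midpointStronglyConvex_penalty hw hε a b) (ENNReal.ofReal lam)
  have hsplit : ENNReal.ofReal ((lam * ε / 2 + c / 2) * ‖a - b‖ ^ 2) =
      ENNReal.ofReal lam * ENNReal.ofReal (ε / 2 * ‖a - b‖ ^ 2) +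
        ENNReal.ofReal (c / 2 * ‖a - b‖ ^ 2) := by
    rw [← ENNReal.ofReal_mul hlam, ← ENNReal.ofReal_add (by positivity) (by positivity)]
    congr 1
    ring
  rw [hsplit]
  change 2 * (ENNReal.ofReal (empiricalRisk φ n x y (midpoint ℝ a b)) +
      ENNReal.ofReal lam * penalty w ε (midpoint ℝ a b)) + _ ≤
    ENNReal.ofReal (empiricalRisk φ n x y a) + ENNReal.ofReal lam * penalty w ε a +
      (ENNReal.ofReal (empiricalRisk φ n x y b) + ENNReal.ofReal lam * penalty w ε b)
  calc _ = (2 * ENNReal.ofReal (empiricalRisk φ n x y (midpoint ℝ a b)) +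
        ENNReal.ofReal (c / 2 * ‖a - b‖ ^ 2)) +
        ENNReal.ofReal lam * (2 * penalty w ε (midpoint ℝ a b) +
          ENNReal.ofReal (ε / 2 * ‖a - b‖ ^ 2)) := by ring
    _ ≤ _ := add_le_add hR hp
    _ = _ := by ring

theorem BoundedFeatures.lowerSemicontinuous_empiricalFunctional (hφ : BoundedFeatures φ κ)
    (n : ℕ) (x : ℕ → 𝓧) (y : ℕ → 𝓨) :
    LowerSemicontinuous (empiricalFunctional φ w ε lam n x y) := by
  refine LowerSemicontinuous.add (Continuous.lowerSemicontinuous ?_) ?_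
  · exact ENNReal.continuous_ofReal.comp (hφ.continuous_empiricalRisk n x y)
  · exact (ENNReal.continuous_const_mul ENNReal.ofReal_ne_top).comp_lowerSemicontinuous
      lowerSemicontinuous_penalty fun a b h => mul_le_mul_right h _

theorem BoundedFeatures.existsUnique_isEstimator (hφ : BoundedFeatures φ κ)
    (hw : ∀ γ, 0 ≤ w γ) (hε : 0 ≤ ε) (hlam : 0 ≤ lam) (n : ℕ) (x : ℕ → 𝓧) (y : ℕ → 𝓨) {c : ℝ}
    (hc : 0 ≤ c) (hlow : ∀ u, c * ‖u‖ ^ 2 ≤ inner ℝ (hφ.meanGram x n u) u)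
    (hpos : 0 < lam * ε / 2 + c / 2) : ∃! β, IsEstimator φ w ε lam n x y β := by
  have h := (hφ.midpointStronglyConvex_empiricalFunctional hw hε hlam n x y hc
    hlow).existsUnique_minimizer hpos (hφ.lowerSemicontinuous_empiricalFunctional n x y)
    convex_univ isClosed_univ (Set.mem_univ (0 : Ell2 Γ)) (by
      simp [empiricalFunctional, penalty, ENNReal.mul_eq_top])
  simp only [Set.mem_univ, true_and, true_imp_iff] at h
  exact h

/-- Minimality against `β₀`, the exact expansion of the risk at `β₀`, and Cauchy–Schwarz for the
linear term. The Gram form stays on the left as the quadratic gain. -/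
theorem BoundedFeatures.basic_inequality (hφ : BoundedFeatures φ κ) (hlam : 0 < lam) {n : ℕ}
    {x : ℕ → 𝓧} {y : ℕ → 𝓨} {β β₀ : Ell2 Γ} (hβ : IsEstimator φ w ε lam n x y β)
    (h₀ : penalty w ε β₀ ≠ ∞) :
    penalty w ε β ≠ ∞ ∧
      inner ℝ (hφ.meanGram x n (β - β₀)) (β - β₀) + lam * (penalty w ε β).toReal ≤
        lam * (penalty w ε β₀).toReal + 2 * (‖hφ.meanScore β₀ x y n‖ * ‖β - β₀‖) := by
  have h : ENNReal.ofReal (empiricalRisk φ n x y β) + ENNReal.ofReal lam * penalty w ε β ≤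
    ENNReal.ofReal (empiricalRisk φ n x y β₀) + ENNReal.ofReal lam * penalty w ε β₀ := hβ β₀
  have hr : ENNReal.ofReal (empiricalRisk φ n x y β₀) + ENNReal.ofReal lam * penalty w ε β₀ ≠ ∞ :=
    ENNReal.add_ne_top.2 ⟨by simp, ENNReal.mul_ne_top (by simp) h₀⟩
  have hl := ne_top_of_le_ne_top hr h
  have hp : penalty w ε β ≠ ∞ := by
    intro htop
    rw [htop, ENNReal.mul_top (by simpa using hlam), add_top] at hl
    exact hl rfl
  refine ⟨hp, ?_⟩
  have h2 := ENNReal.toReal_mono hr h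
  rw [ENNReal.toReal_add (by simp) (ENNReal.mul_ne_top (by simp) hp),
    ENNReal.toReal_add (by simp) (ENNReal.mul_ne_top (by simp) h₀), ENNReal.toReal_mul,
    ENNReal.toReal_mul, ENNReal.toReal_ofReal (empiricalRisk_nonneg n x y β),
    ENNReal.toReal_ofReal (empiricalRisk_nonneg n x y β₀), ENNReal.toReal_ofReal hlam.le,
    hφ.empiricalRisk_eq n x y β β₀] at h2
  have h3 := real_inner_le_norm (hφ.meanScore β₀ x y n) (β - β₀)
  linarith

end EmpiricalRisk

noncomputable instance measurableSpace_ell2 {Γ : Type*} : MeasurableSpace (Ell2 Γ) := borel _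

instance borelSpace_ell2 {Γ : Type*} : BorelSpace (Ell2 Γ) := ⟨rfl⟩

/-- Keep only the fourth-order term of the exponential series. It turns the exponential moment of
the noise into a fourth moment. -/
theorem pow_four_le_exp {t : ℝ} (ht : 0 ≤ t) : t ^ 4 ≤ 24 * (Real.exp t - t - 1) := by
  have h := Real.sum_le_exp_of_nonneg ht 5
  simp only [Finset.sum_range_succ, Finset.sum_range_zero, Nat.factorial] at h
  norm_num at h
  nlinarith [pow_nonneg ht 2, pow_nonneg ht 3]

/-! ### Moments of the score and the covariance operator -/

section Population

variable {Γ 𝓧 𝓨 : Type*} [MeasurableSpace 𝓧]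
  [NormedAddCommGroup 𝓨] [InnerProductSpace ℝ 𝓨] [CompleteSpace 𝓨] [MeasurableSpace 𝓨]
  {φ : Γ → 𝓧 → 𝓨} {κ : ℝ} {w : Γ → ℝ} {βstar : Ell2 Γ} {σ L : ℝ} {P : Measure (𝓧 × 𝓨)}

theorem BoundedFeatures.norm_gram_le (hφ : BoundedFeatures φ κ) (x : 𝓧) :
    ‖hφ.gram x‖ ≤ √κ * √κ := by
  refine (ContinuousLinearMap.opNorm_comp_le _ _).trans ?_
  rw [LinearIsometryEquiv.norm_map]
  gcongr <;> exact hφ.norm_op_le x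

theorem BoundedFeatures.norm_score_le (hφ : BoundedFeatures φ κ) (β : Ell2 Γ) (z : 𝓧 × 𝓨) :
    ‖hφ.score β z‖ ≤ √κ * ‖noise φ β z‖ := by
  refine (ContinuousLinearMap.le_opNorm _ _).trans ?_
  rw [LinearIsometryEquiv.norm_map]
  gcongr
  exact hφ.norm_op_le z.1

theorem predictionError_le [IsProbabilityMeasure P] (hφ : BoundedFeatures φ κ) {β₀ βstar : Ell2 Γ}
    (h₀ : ∀ᵐ z ∂P, predictor φ β₀ z.1 = predictor φ βstar z.1) (β : Ell2 Γ) :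
    predictionError φ P β βstar ≤ ENNReal.ofReal ((√κ * ‖β - β₀‖) ^ 2) := by
  have h : ∀ᵐ z ∂P, ‖predictor φ β z.1 - predictor φ βstar z.1‖ₑ ^ 2 ≤
      ENNReal.ofReal ((√κ * ‖β - β₀‖) ^ 2) := by
    filter_upwards [h₀] with z hz
    rw [← hz, ← hφ.predictor_sub, ENNReal.ofReal_pow (by positivity), ← ofReal_norm]
    gcongr
    rw [← hφ.op_apply]
    exact (ContinuousLinearMap.le_opNorm _ _).trans (by gcongr; exact hφ.norm_op_le _)
  refine (lintegral_mono_ae h).trans ?_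
  simp

theorem tendsto_predictionError [IsProbabilityMeasure P] (hφ : BoundedFeatures φ κ)
    {β₀ βstar : Ell2 Γ} (h₀ : ∀ᵐ z ∂P, predictor φ β₀ z.1 = predictor φ βstar z.1)
    {b : ℕ → Ell2 Γ} (hb : Tendsto (fun n => ‖b n - β₀‖) atTop (𝓝 0)) :
    Tendsto (fun n => predictionError φ P (b n) βstar) atTop (𝓝 0) := by
  have h := ENNReal.tendsto_ofReal ((hb.const_mul √κ).pow 2)
  simp only [mul_zero, ne_eq, OfNat.ofNat_ne_zero, not_false_eq_true, zero_pow,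
    ENNReal.ofReal_zero] at h
  exact tendsto_of_tendsto_of_tendsto_of_le_of_le tendsto_const_nhds h (fun _ => zero_le)
    fun n => predictionError_le hφ h₀ (b n)

variable [Countable Γ] [BorelSpace 𝓨] [SecondCountableTopology 𝓨]

theorem BoundedFeatures.measurable_predictor (hφ : BoundedFeatures φ κ) (β : Ell2 Γ) :
    Measurable (predictor φ β) := by
  exact ((ContinuousLinearMap.apply ℝ 𝓨 β).continuous.comp_stronglyMeasurable
    hφ.stronglyMeasurable_op).measurable

theorem BoundedFeatures.measurable_noise (hφ : BoundedFeatures φ κ) (β : Ell2 Γ) :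
    Measurable (noise φ β : 𝓧 × 𝓨 → 𝓨) :=
  measurable_snd.sub ((hφ.measurable_predictor β).comp measurable_fst)

theorem BoundedFeatures.stronglyMeasurable_gram (hφ : BoundedFeatures φ κ) :
    StronglyMeasurable hφ.gram := by
  have h : Continuous fun A : Ell2 Γ →L[ℝ] 𝓨 => (ContinuousLinearMap.adjoint A).comp A :=
    (ContinuousLinearMap.adjoint.continuous).clm_comp continuous_id
  exact h.comp_stronglyMeasurable hφ.stronglyMeasurable_op

theorem BoundedFeatures.measurable_score (hφ : BoundedFeatures φ κ) (β : Ell2 Γ) :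
    Measurable (hφ.score β : 𝓧 × 𝓨 → Ell2 Γ) := by
  have h : Continuous fun p : (Ell2 Γ →L[ℝ] 𝓨) × 𝓨 => ContinuousLinearMap.adjoint p.1 p.2 :=
    ((ContinuousLinearMap.adjoint.continuous).comp continuous_fst).clm_apply continuous_snd
  exact (h.comp_stronglyMeasurable
    ((hφ.stronglyMeasurable_op.comp_measurable measurable_fst).prodMk
      (hφ.measurable_noise β).stronglyMeasurable)).measurable

theorem RegressionModel.memLp_noise [IsFiniteMeasure P] (hφ : BoundedFeatures φ κ)
    (hmodel : RegressionModel φ w βstar σ L P) : MemLp (noise φ βstar) 4 P := by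
  have hL := hmodel.L_pos
  have hm := (hφ.measurable_noise βstar).aestronglyMeasurable (μ := P)
  have hint : Integrable (fun z => ‖noise φ βstar z‖ ^ 4) P := by
    refine (hmodel.integrable_noiseExp.const_mul (24 * L ^ 4)).mono' (hm.norm.pow 4)
      (Eventually.of_forall fun z => ?_)
    have h := pow_four_le_exp (t := ‖noise φ βstar z‖ / L) (by positivity)
    rw [Real.norm_of_nonneg (by positivity), noiseExp]
    rw [div_pow, div_le_iff₀ (by positivity)] at h
    linarith
  rw [← integrable_norm_rpow_iff hm (by norm_num) (by norm_num)]
  simpa using hint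

theorem RegressionModel.memLp_score [IsFiniteMeasure P] (hφ : BoundedFeatures φ κ)
    (hmodel : RegressionModel φ w βstar σ L P) : MemLp (hφ.score βstar) 4 P :=
  (hmodel.memLp_noise hφ).of_le_mul (hφ.measurable_score βstar).aestronglyMeasurable
    (Eventually.of_forall (hφ.norm_score_le βstar))

/-- Tested against `u`, the score is the inner product of the noise with `f_u(X)`. The latter is a
function of `X` and leaves the conditional expectation, where the noise has mean zero. -/
theorem RegressionModel.integral_score [IsFiniteMeasure P] (hφ : BoundedFeatures φ κ)
    (hmodel : RegressionModel φ w βstar σ L P) : ∫ z, hφ.score βstar z ∂P = 0 := by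
  have hint : Integrable (hφ.score βstar) P := (hmodel.memLp_score hφ).integrable (by norm_num)
  refine ext_inner_left ℝ fun u => ?_
  rw [← integral_inner hint, inner_zero_right]
  have hle : sigmaX 𝓧 𝓨 ≤ (inferInstance : MeasurableSpace (𝓧 × 𝓨)) := measurable_fst.comap_le
  have hf : StronglyMeasurable[sigmaX 𝓧 𝓨] fun z : 𝓧 × 𝓨 => predictor φ u z.1 :=
    (hφ.measurable_predictor u).stronglyMeasurable.comp_measurable
      (comap_measurable (Prod.fst : 𝓧 × 𝓨 → 𝓧))
  have heq : (fun z => inner ℝ u (hφ.score βstar z)) =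
      fun z => innerSL ℝ (predictor φ u z.1) (noise φ βstar z) := by
    ext z
    rw [real_inner_comm, hφ.inner_score, real_inner_comm]
    rfl
  have hfg : Integrable (fun z => innerSL ℝ (predictor φ u z.1) (noise φ βstar z)) P := by
    rw [← heq]
    exact hint.const_inner u
  have hpull := condExp_bilin_of_stronglyMeasurable_left (innerSL ℝ) hf hfg hmodel.integrable_noise
  rw [heq, ← integral_condExp hle, integral_congr_ae hpull,
    integral_congr_ae (g := fun _ => (0 : ℝ)), integral_zero]
  filter_upwards [hmodel.zero_mean] with z hz
  rw [hz]
  simp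

/-- The operator `E[Φ_X^* Φ_X]` on `ℓ₂`. -/
noncomputable def BoundedFeatures.covariance (hφ : BoundedFeatures φ κ) (P : Measure (𝓧 × 𝓨)) :
    Ell2 Γ →L[ℝ] Ell2 Γ :=
  ∫ z, hφ.gram z.1 ∂P

variable [IsFiniteMeasure P]

theorem BoundedFeatures.integrable_gram (hφ : BoundedFeatures φ κ) :
    Integrable (fun z : 𝓧 × 𝓨 => hφ.gram z.1) P :=
  Integrable.of_bound (hφ.stronglyMeasurable_gram.comp_measurable
    measurable_fst).aestronglyMeasurable (√κ * √κ)
    (Eventually.of_forall fun z => hφ.norm_gram_le z.1)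

theorem BoundedFeatures.integrable_sq_norm_predictor (hφ : BoundedFeatures φ κ) (u : Ell2 Γ) :
    Integrable (fun z : 𝓧 × 𝓨 => ‖predictor φ u z.1‖ ^ 2) P := by
  simp_rw [← hφ.inner_gram]
  exact (hφ.integrable_gram.apply_continuousLinearMap u).inner_const u

theorem BoundedFeatures.inner_covariance (hφ : BoundedFeatures φ κ) (u : Ell2 Γ) :
    inner ℝ (hφ.covariance P u) u = ∫ z, ‖predictor φ u z.1‖ ^ 2 ∂P := by
  rw [covariance, ContinuousLinearMap.integral_apply hφ.integrable_gram, real_inner_comm,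
    ← integral_inner (hφ.integrable_gram.apply_continuousLinearMap u)]
  refine integral_congr_ae (Eventually.of_forall fun z => ?_)
  simp only
  rw [real_inner_comm, hφ.inner_gram]

theorem BoundedFeatures.inner_covariance_nonneg (hφ : BoundedFeatures φ κ) (u : Ell2 Γ) :
    0 ≤ inner ℝ (hφ.covariance P u) u := by
  rw [hφ.inner_covariance]
  exact integral_nonneg fun z => by positivity

theorem BoundedFeatures.inner_covariance_nonpos_iff (hφ : BoundedFeatures φ κ) (u : Ell2 Γ) :
    inner ℝ (hφ.covariance P u) u ≤ 0 ↔ ∀ᵐ z ∂P, predictor φ u z.1 = 0 := by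
  rw [(hφ.inner_covariance_nonneg u).ge_iff_eq', hφ.inner_covariance,
    integral_eq_zero_iff_of_nonneg (fun z => by positivity) (hφ.integrable_sq_norm_predictor u)]
  refine eventually_congr (Eventually.of_forall fun z => ?_)
  simp

theorem BoundedFeatures.ofReal_inner_covariance (hφ : BoundedFeatures φ κ) (u : Ell2 Γ) :
    ENNReal.ofReal (inner ℝ (hφ.covariance P u) u) = ∫⁻ z, ‖predictor φ u z.1‖ₑ ^ 2 ∂P := by
  rw [hφ.inner_covariance, ofReal_integral_eq_lintegral_ofReal (hφ.integrable_sq_norm_predictor u)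
    (Eventually.of_forall fun z => by positivity)]
  refine lintegral_congr fun z => ?_
  rw [ENNReal.ofReal_pow (norm_nonneg _), ofReal_norm]

theorem IsLowerSpectralBound.le_inner_covariance (hφ : BoundedFeatures φ κ) {κ₀ : ℝ}
    (hκ₀ : IsLowerSpectralBound φ P κ₀) (u : Ell2 Γ) :
    κ₀ * ‖u‖ ^ 2 ≤ inner ℝ (hφ.covariance P u) u := by
  by_cases hu : u = 0
  · simp [hu]
  have hn : 0 < ‖u‖ := norm_pos_iff.2 hu
  have h := hκ₀ (‖u‖⁻¹ • u) (by rw [norm_smul, norm_inv, norm_norm, inv_mul_cancel₀ hn.ne'])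
  rw [← hφ.ofReal_inner_covariance, ENNReal.ofReal_le_ofReal_iff (hφ.inner_covariance_nonneg _),
    map_smul, real_inner_smul_left, real_inner_smul_right] at h
  calc κ₀ * ‖u‖ ^ 2 ≤ (‖u‖⁻¹ * (‖u‖⁻¹ * inner ℝ (hφ.covariance P u) u)) * ‖u‖ ^ 2 := by gcongr
    _ = _ := by field_simp

end Population

/-! ### Almost sure limits along the sample -/

section Sample

variable {Ω 𝓧 𝓨 : Type*} [MeasurableSpace Ω] [MeasurableSpace 𝓧] [MeasurableSpace 𝓨]
  {μ : Measure Ω} {P : Measure (𝓧 × 𝓨)} {X : ℕ → Ω → 𝓧} {Y : ℕ → Ω → 𝓨}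

theorem IIDSample.ae_forall (hsample : IIDSample μ P X Y) {p : 𝓧 × 𝓨 → Prop}
    (hp : ∀ᵐ z ∂P, p z) : ∀ᵐ ω ∂μ, ∀ i, p (X i ω, Y i ω) := by
  refine ae_all_iff.2 fun i => ?_
  rw [← hsample.law i] at hp
  exact ae_of_ae_map (hsample.measurable i).aemeasurable hp

theorem IIDSample.integral_comp (hsample : IIDSample μ P X Y) {E : Type*} [NormedAddCommGroup E]
    [NormedSpace ℝ E] {f : 𝓧 × 𝓨 → E} (hf : StronglyMeasurable f) (i : ℕ) :
    ∫ ω, f (X i ω, Y i ω) ∂μ = ∫ z, f z ∂P := by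
  conv_rhs => rw [← hsample.law i]
  rw [integral_map (hsample.measurable i).aemeasurable hf.aestronglyMeasurable]

theorem IIDSample.ae_tendsto_mean (hsample : IIDSample μ P X Y) {E : Type*} [NormedAddCommGroup E]
    [NormedSpace ℝ E] [CompleteSpace E] {f : 𝓧 × 𝓨 → E} (hf : StronglyMeasurable f)
    (hint : Integrable f P) :
    ∀ᵐ ω ∂μ, Tendsto (fun n : ℕ => (n : ℝ)⁻¹ • ∑ i ∈ Finset.range n, f (X i ω, Y i ω)) atTop
      (𝓝 (∫ z, f z ∂P)) := by
  borelize E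
  have hident : ∀ i, IdentDistrib (fun ω => f (X i ω, Y i ω)) (fun ω => f (X 0 ω, Y 0 ω)) μ μ :=
    fun i => IdentDistrib.comp ⟨(hsample.measurable i).aemeasurable,
      (hsample.measurable 0).aemeasurable, by rw [hsample.law, hsample.law]⟩ hf.measurable
  have h0 : Integrable (fun ω => f (X 0 ω, Y 0 ω)) μ := by
    rw [← hsample.law 0] at hint
    exact hint.comp_measurable (hsample.measurable 0)
  rw [← hsample.integral_comp hf 0]
  exact strong_law_ae (fun i ω => f (X i ω, Y i ω)) h0
    (fun i j hij => (hsample.indep.indepFun hij).comp hf.measurable hf.measurable) hident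

variable {Γ : Type*} [Countable Γ] [NormedAddCommGroup 𝓨] [InnerProductSpace ℝ 𝓨]
  [CompleteSpace 𝓨] [BorelSpace 𝓨] [SecondCountableTopology 𝓨] {φ : Γ → 𝓧 → 𝓨} {κ : ℝ}
  {w : Γ → ℝ} {βstar : Ell2 Γ} {σ L : ℝ} [IsProbabilityMeasure P]

theorem IIDSample.ae_tendsto_meanGram (hsample : IIDSample μ P X Y) (hφ : BoundedFeatures φ κ) :
    ∀ᵐ ω ∂μ, Tendsto (hφ.meanGram (X · ω)) atTop (𝓝 (hφ.covariance P)) :=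
  hsample.ae_tendsto_mean (hφ.stronglyMeasurable_gram.comp_measurable measurable_fst)
    hφ.integrable_gram

theorem IIDSample.ae_tendsto_meanScore (hsample : IIDSample μ P X Y) (hφ : BoundedFeatures φ κ)
    (hmodel : RegressionModel φ w βstar σ L P) :
    ∀ᵐ ω ∂μ, Tendsto (hφ.meanScore βstar (X · ω) (Y · ω)) atTop (𝓝 0) := by
  rw [← hmodel.integral_score hφ]
  exact hsample.ae_tendsto_mean (hφ.measurable_score βstar).stronglyMeasurable
    ((hmodel.memLp_score hφ).integrable (by norm_num))

theorem IIDSample.ae_tendsto_norm_meanScore_div [IsProbabilityMeasure μ] (hsample : IIDSample μ P X Y)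
    (hφ : BoundedFeatures φ κ) (hmodel : RegressionModel φ w βstar σ L P) :
    ∀ᵐ ω ∂μ, ∀ lam : ℕ → ℝ, (∀ᶠ n in atTop, 0 < lam n) →
      (∀ᶠ n : ℕ in atTop, 2 * Real.log n ≤ n * lam n ^ 2) →
      Tendsto (fun n => ‖hφ.meanScore βstar (X · ω) (Y · ω) n‖ / lam n) atTop (𝓝 0) := by
  have hs := hφ.measurable_score βstar
  refine ae_tendsto_norm_mean_div (ξ := fun i ω => hφ.score βstar (X i ω, Y i ω))
    (m := ∫ z, ‖hφ.score βstar z‖ ^ 2 ∂P) (M := ∫ z, ‖hφ.score βstar z‖ ^ 4 ∂P)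
    (hsample.indep.comp (fun _ => hφ.score βstar) fun _ => hs)
    (fun i => hs.comp (hsample.measurable i)) (fun i => ?_) (fun i => ?_) (fun i => ?_)
    (fun i => ?_)
  · have h := hmodel.memLp_score hφ
    rw [← hsample.law i] at h
    exact h.comp_of_map (hsample.measurable i).aemeasurable
  · rw [hsample.integral_comp hs.stronglyMeasurable, hmodel.integral_score hφ]
  · exact (hsample.integral_comp (hs.stronglyMeasurable.norm.pow 2) i).le
  · exact (hsample.integral_comp (hs.stronglyMeasurable.norm.pow 4) i).le

end Sample

/-- Absorbing `2 c u ≤ u² + c²` leaves `u² ≤ 2a + c²`. -/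
theorem tendsto_zero_of_sq_le {u a c : ℕ → ℝ} (hu : ∀ n, 0 ≤ u n)
    (h : ∀ᶠ n in atTop, u n ^ 2 ≤ a n + c n * u n) (ha : Tendsto a atTop (𝓝 0))
    (hc : Tendsto c atTop (𝓝 0)) : Tendsto u atTop (𝓝 0) := by
  have h1 : Tendsto (fun n => √(2 * a n + c n ^ 2)) atTop (𝓝 0) := by
    have := (Real.continuous_sqrt.tendsto _).comp ((ha.const_mul 2).add (hc.pow 2))
    simpa [Function.comp_def] using this
  refine squeeze_zero' (Eventually.of_forall hu) ?_ h1
  filter_upwards [h] with n hn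
  refine Real.le_sqrt_of_sq_le ?_
  nlinarith [sq_nonneg (u n - c n)]

/-! ### Deterministic consistency along a good sample path -/

section Consistency

variable {Γ 𝓧 𝓨 : Type*} [MeasurableSpace 𝓧] [NormedAddCommGroup 𝓨] [InnerProductSpace ℝ 𝓨]
  [CompleteSpace 𝓨] [MeasurableSpace 𝓨]
  {φ : Γ → 𝓧 → 𝓨} {κ : ℝ} {w : Γ → ℝ} {ε : ℝ} {βstar β₀ : Ell2 Γ} {P : Measure (𝓧 × 𝓨)}

theorem inner_apply_le_add (T T' : Ell2 Γ →L[ℝ] Ell2 Γ) (u : Ell2 Γ) :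
    inner ℝ (T u) u ≤ inner ℝ (T' u) u + ‖T - T'‖ * ‖u‖ ^ 2 := by
  have h1 : inner ℝ ((T - T') u) u = inner ℝ (T u) u - inner ℝ (T' u) u := by
    rw [_root_.sub_apply, inner_sub_left]
  have h2 := real_inner_le_norm ((T - T') u) u
  have h3 := mul_le_mul_of_nonneg_right ((T - T').le_opNorm u) (norm_nonneg u)
  nlinarith

/-- Equal predictions at the sample points give equal residuals, so probabilistic bounds on the
score at `βstar` transfer to the representation. -/
theorem BoundedFeatures.meanScore_congr (hφ : BoundedFeatures φ κ) {x : ℕ → 𝓧} (y : ℕ → 𝓨)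
    (h : ∀ i, predictor φ β₀ (x i) = predictor φ βstar (x i)) (n : ℕ) :
    hφ.meanScore β₀ x y n = hφ.meanScore βstar x y n := by
  simp only [meanScore, score, noise, h]

theorem BoundedFeatures.isClosed_covariance_le (hφ : BoundedFeatures φ κ) (β₀ : Ell2 Γ) (δ : ℝ) :
    IsClosed {β | inner ℝ (hφ.covariance P (β - β₀)) (β - β₀) ≤ δ} :=
  isClosed_le (by fun_prop) continuous_const

variable [Countable Γ] [BorelSpace 𝓨] [SecondCountableTopology 𝓨] [IsProbabilityMeasure P]

/-- For the quadratic form `q` of the covariance, `q(su + tv) = s q(u) + t q(v) - st q(u - v)` when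
`s + t = 1`, and `q` is nonnegative. -/
theorem BoundedFeatures.convex_covariance_le (hφ : BoundedFeatures φ κ) (β₀ : Ell2 Γ) (δ : ℝ) :
    Convex ℝ {β | inner ℝ (hφ.covariance P (β - β₀)) (β - β₀) ≤ δ} := by
  intro a ha b hb s t hs ht hst
  have h := hφ.inner_covariance_nonneg (P := P) ((a - β₀) - (b - β₀))
  have hsplit : s • a + t • b - β₀ = s • (a - β₀) + t • (b - β₀) := by
    have : β₀ = s • β₀ + t • β₀ := by rw [← add_smul, hst, one_smul]
    conv_lhs => rw [this]
    rw [smul_sub, smul_sub]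
    abel
  simp only [Set.mem_ofPred_eq] at ha hb ⊢
  rw [hsplit]
  generalize a - β₀ = u at *
  generalize b - β₀ = v at *
  simp only [map_sub, map_add, map_smul, inner_sub_left, inner_sub_right, inner_add_left,
    inner_add_right, real_inner_smul_left, real_inner_smul_right] at *
  have ht' : t = 1 - s := by linarith
  have hst' : 0 ≤ s * t := mul_nonneg hs ht
  have h1 := mul_le_mul_of_nonneg_left ha hs
  have h2 := mul_le_mul_of_nonneg_left hb ht
  have h3 := mul_nonneg hst' h
  subst ht'
  nlinarith

theorem BoundedFeatures.predictor_ae_eq_iff (hφ : BoundedFeatures φ κ) (β β₀ : Ell2 Γ) :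
    (∀ᵐ z ∂P, predictor φ β z.1 = predictor φ β₀ z.1) ↔
      inner ℝ (hφ.covariance P (β - β₀)) (β - β₀) ≤ 0 := by
  rw [hφ.inner_covariance_nonpos_iff]
  simp_rw [hφ.predictor_sub, sub_eq_zero]

theorem BoundedFeatures.existsUnique_isRepresentation (hφ : BoundedFeatures φ κ)
    (hw : ∀ γ, 0 ≤ w γ) (hε : 0 < ε) (hstar : Summable fun γ => w γ * |βstar γ|) :
    ∃! β, IsRepresentation φ w ε P βstar β := by
  have h := (midpointStronglyConvex_penalty hw hε.le).existsUnique_minimizer (half_pos hε)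
    lowerSemicontinuous_penalty (hφ.convex_covariance_le (P := P) βstar 0)
    (hφ.isClosed_covariance_le βstar 0) (a := βstar) (by simp) (penalty_ne_top hstar)
  simp only [Set.mem_ofPred_eq, ← hφ.predictor_ae_eq_iff] at h
  exact h

theorem IsLowerSpectralBound.eq_of_predictor_ae_eq (hφ : BoundedFeatures φ κ) {κ₀ : ℝ}
    (hpos : 0 < κ₀) (hκ₀ : IsLowerSpectralBound φ P κ₀) {β : Ell2 Γ}
    (h : ∀ᵐ z ∂P, predictor φ β z.1 = predictor φ β₀ z.1) : β = β₀ := by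
  rw [hφ.predictor_ae_eq_iff] at h
  have h1 := (hκ₀.le_inner_covariance hφ (β - β₀)).trans h
  have h2 : ‖β - β₀‖ ^ 2 ≤ 0 := nonpos_of_mul_nonpos_right h1 hpos
  have h3 : ‖β - β₀‖ = 0 := pow_eq_zero_iff two_ne_zero |>.1 (le_antisymm h2 (sq_nonneg _))
  exact sub_eq_zero.1 (norm_eq_zero.1 h3)

theorem IsLowerSpectralBound.isRepresentation (hφ : BoundedFeatures φ κ) {κ₀ : ℝ}
    (hpos : 0 < κ₀) (hκ₀ : IsLowerSpectralBound φ P κ₀) :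
    IsRepresentation φ w ε P βstar βstar :=
  ⟨Eventually.of_forall fun _ => rfl, fun _ hβ => by
    rw [hκ₀.eq_of_predictor_ae_eq hφ hpos hβ]⟩

variable {lam : ℕ → ℝ} {x : ℕ → 𝓧} {y : ℕ → 𝓨} {b : ℕ → Ell2 Γ}

theorem BoundedFeatures.tendsto_estimator (hφ : BoundedFeatures φ κ) (hw : ∀ γ, 0 ≤ w γ)
    (hε : 0 < ε) (hβ₀ : IsRepresentation φ w ε P βstar β₀) (hfin : penalty w ε β₀ ≠ ∞)
    (hlam : ∀ᶠ n in atTop, 0 < lam n) (hlam0 : Tendsto lam atTop (𝓝 0))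
    (hgram : Tendsto (hφ.meanGram x) atTop (𝓝 (hφ.covariance P)))
    (hscore : Tendsto (fun n => ‖hφ.meanScore β₀ x y n‖ / lam n) atTop (𝓝 0))
    (hb : ∀ᶠ n in atTop, IsEstimator φ w ε (lam n) n x y (b n)) :
    Tendsto b atTop (𝓝 β₀) := by
  set s : ℕ → ℝ := fun n => ‖hφ.meanScore β₀ x y n‖ / lam n with hs
  set p₀ := (penalty w ε β₀).toReal with hp₀
  -- Once `s n ≤ 1`, a vector with `‖b n‖ ≥ 1` satisfies `ε ‖b n‖² ≤ p₀ + 2‖b n‖ + 2‖β₀‖ ≤ (p₀ +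
  -- 2‖β₀‖ + 2) ‖b n‖`. The extra 1 guarantees that any norm above `B` is at least 1.
  set B : ℝ := (p₀ + 2 * ‖β₀‖ + 2) / ε + 1 with hB
  set U : ℝ := B + ‖β₀‖ with hU
  have hp₀nn : 0 ≤ p₀ := ENNReal.toReal_nonneg
  have hB1 : 1 ≤ B := by rw [hB]; linarith [show 0 ≤ (p₀ + 2 * ‖β₀‖ + 2) / ε by positivity]
  have key : ∀ᶠ n in atTop, penalty w ε (b n) ≠ ∞ ∧ 0 ≤ s n ∧ ‖b n - β₀‖ ≤ U ∧
      (penalty w ε (b n)).toReal ≤ p₀ + 2 * s n * U ∧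
      inner ℝ (hφ.meanGram x n (b n - β₀)) (b n - β₀) ≤ lam n * (p₀ + 2 * s n * U) := by
    filter_upwards [hb, hlam, hscore.eventually (ge_mem_nhds one_pos)] with n hbn hln hs1
    obtain ⟨hpfin, hbasic⟩ := hφ.basic_inequality hln hbn hfin
    have hsn : 0 ≤ s n := by positivity
    have hsl : ‖hφ.meanScore β₀ x y n‖ = lam n * s n := by rw [hs]; field_simp
    have hgn := hφ.inner_meanGram_nonneg x n (b n - β₀)
    rw [hsl] at hbasic
    have h1 : (penalty w ε (b n)).toReal ≤ p₀ + 2 * s n * ‖b n - β₀‖ := by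
      refine le_of_mul_le_mul_left ?_ hln
      linarith
    have h2 : ε * ‖b n‖ ^ 2 ≤ (penalty w ε (b n)).toReal := by
      have := ENNReal.toReal_mono hpfin (ofReal_mul_sq_norm_le_penalty hw hε.le (b n))
      rwa [ENNReal.toReal_ofReal (by positivity)] at this
    have h3 : ‖b n‖ ≤ B := by
      by_contra! hcon
      have h4 : 2 * s n * ‖b n - β₀‖ ≤ 2 * (‖b n‖ + ‖β₀‖) := by
        have := norm_sub_le (b n) β₀
        have hs1' : s n ≤ 1 := hs1
        nlinarith [norm_nonneg (b n - β₀)]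
      have h5 : ε * ‖b n‖ ^ 2 ≤ (p₀ + 2 * ‖β₀‖ + 2) * ‖b n‖ := by
        have : 1 ≤ ‖b n‖ := hB1.trans hcon.le
        nlinarith [norm_nonneg β₀]
      have h6 : ε * ‖b n‖ ≤ p₀ + 2 * ‖β₀‖ + 2 := by
        have : 0 < ‖b n‖ := by linarith
        refine le_of_mul_le_mul_right ?_ this
        linarith
      have h7 : ‖b n‖ ≤ (p₀ + 2 * ‖β₀‖ + 2) / ε := by
        rw [le_div_iff₀ hε]; linarith
      linarith
    have h8 : ‖b n - β₀‖ ≤ U := (norm_sub_le _ _).trans (by linarith)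
    have h9 : 2 * s n * ‖b n - β₀‖ ≤ 2 * s n * U := by gcongr
    refine ⟨hpfin, hsn, h8, h1.trans (by linarith), ?_⟩
    have h10 : 0 ≤ lam n * (penalty w ε (b n)).toReal := by positivity
    have h11 := mul_le_mul_of_nonneg_left h9 hln.le
    linarith
  have hr : Tendsto (fun n => 2 * s n * U) atTop (𝓝 0) := by
    simpa using (hscore.const_mul 2).mul_const U
  refine (midpointStronglyConvex_penalty hw hε.le).tendsto_minimizer (half_pos hε)
    lowerSemicontinuous_penalty
    -- These sets relax the constraint `f_β = f_β₀` almost surely, which the estimator meets only in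
    -- the limit; their intersection is exactly that constraint.
    (K := fun k : ℕ => {β | inner ℝ (hφ.covariance P (β - β₀)) (β - β₀) ≤ 1 / ((k : ℝ) + 1)})
    (fun i j hij β hβ => ?_) (fun k => hφ.convex_covariance_le β₀ _)
    (fun k => hφ.isClosed_covariance_le β₀ _) (fun k => ?_) hfin (fun β hβ => ?_) (fun k => ?_)
    hr ?_
  · have hij' : (i : ℝ) ≤ j := by exact_mod_cast hij
    have hle : (1 : ℝ) / ((j : ℝ) + 1) ≤ 1 / ((i : ℝ) + 1) := by gcongr
    simp only [Set.mem_ofPred_eq] at hβ ⊢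
    exact hβ.trans hle
  · simp only [Set.mem_ofPred_eq, sub_self, map_zero, inner_zero_left]
    positivity
  · have h0 : inner ℝ (hφ.covariance P (β - β₀)) (β - β₀) ≤ 0 :=
      ge_of_tendsto' tendsto_one_div_add_atTop_nhds_zero_nat hβ
    refine hβ₀.2 β ?_
    filter_upwards [(hφ.predictor_ae_eq_iff β β₀).2 h0, hβ₀.1] with z h1 h2
    rw [h1, h2]
  -- The basic inequality bounds the empirical form. Passing to the covariance costs the
  -- operator-norm gap times `U ^ 2`, which vanishes because the errors are bounded.
  · have hg0 : Tendsto (fun n => ‖hφ.covariance P - hφ.meanGram x n‖) atTop (𝓝 0) := by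
      simpa [norm_sub_rev] using tendsto_iff_norm_sub_tendsto_zero.1 hgram
    have hlim : Tendsto (fun n => lam n * (p₀ + 2 * s n * U) +
        ‖hφ.covariance P - hφ.meanGram x n‖ * U ^ 2) atTop (𝓝 0) := by
      simpa using (hlam0.mul (hr.const_add p₀)).add (hg0.mul_const (U ^ 2))
    filter_upwards [key, hlim.eventually (ge_mem_nhds (show (0 : ℝ) < 1 / ((k : ℝ) + 1) by
      positivity))] with n ⟨_, _, h3, _, h5⟩ h6
    refine le_trans ((inner_apply_le_add _ (hφ.meanGram x n) _).trans ?_) h6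
    gcongr
  · filter_upwards [key] with n ⟨h1, h2, _, h4, _⟩
    have hU0 : 0 ≤ U := by positivity
    rw [← ENNReal.ofReal_toReal h1, ← ENNReal.ofReal_toReal hfin,
      ← ENNReal.ofReal_add hp₀nn (by positivity)]
    exact ENNReal.ofReal_le_ofReal h4

/-- Operator-norm convergence perturbs the quadratic form by at most `κ₀ / 2 * ‖u‖ ^ 2` uniformly in
`u`, leaving half of the lower bound. -/
theorem IsLowerSpectralBound.eventually_le_inner_meanGram (hφ : BoundedFeatures φ κ) {κ₀ : ℝ}
    (hpos : 0 < κ₀) (hκ₀ : IsLowerSpectralBound φ P κ₀)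
    (hgram : Tendsto (hφ.meanGram x) atTop (𝓝 (hφ.covariance P))) :
    ∀ᶠ n in atTop, ∀ u, κ₀ / 2 * ‖u‖ ^ 2 ≤ inner ℝ (hφ.meanGram x n u) u := by
  have hg0 : Tendsto (fun n => ‖hφ.covariance P - hφ.meanGram x n‖) atTop (𝓝 0) := by
    simpa [norm_sub_rev] using tendsto_iff_norm_sub_tendsto_zero.1 hgram
  filter_upwards [hg0.eventually (ge_mem_nhds (half_pos hpos))] with n hn u
  have h1 := hκ₀.le_inner_covariance hφ u
  have h2 := inner_apply_le_add (hφ.covariance P) (hφ.meanGram x n) u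
  have h3 := mul_le_mul_of_nonneg_right hn (sq_nonneg ‖u‖)
  linarith

theorem IsLowerSpectralBound.tendsto_estimator (hφ : BoundedFeatures φ κ) {κ₀ : ℝ}
    (hpos : 0 < κ₀) (hκ₀ : IsLowerSpectralBound φ P κ₀) (hfin : penalty w ε βstar ≠ ∞)
    (hlam : ∀ᶠ n in atTop, 0 < lam n) (hlam0 : Tendsto lam atTop (𝓝 0))
    (hgram : Tendsto (hφ.meanGram x) atTop (𝓝 (hφ.covariance P)))
    (hscore : Tendsto (hφ.meanScore βstar x y) atTop (𝓝 0))
    (hb : ∀ᶠ n in atTop, IsEstimator φ w ε (lam n) n x y (b n)) :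
    Tendsto (fun n => ‖b n - βstar‖) atTop (𝓝 0) := by
  refine tendsto_zero_of_sq_le (a := fun n => lam n * (2 / κ₀ * (penalty w ε βstar).toReal))
    (c := fun n => 4 / κ₀ * ‖hφ.meanScore βstar x y n‖) (fun n => norm_nonneg _) ?_
    (by simpa using hlam0.mul_const _) (by simpa using hscore.norm.const_mul (4 / κ₀))
  filter_upwards [hb, hlam, hκ₀.eventually_le_inner_meanGram hφ hpos hgram] with n hbn hln hn
  obtain ⟨-, h⟩ := hφ.basic_inequality hln hbn hfin
  have h1 := hn (b n - βstar)
  have h2 : 0 ≤ lam n * (penalty w ε (b n)).toReal := by positivity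
  have h3 : κ₀ / 2 * ‖b n - βstar‖ ^ 2 ≤ lam n * (penalty w ε βstar).toReal +
      2 * (‖hφ.meanScore βstar x y n‖ * ‖b n - βstar‖) := by linarith
  refine le_of_mul_le_mul_left (h3.trans_eq ?_) (half_pos hpos)
  field_simp
  ring

end Consistency

end ElasticNet

/-! ### Assembly of the two cases -/

theorem theorem4 {Ω Γ 𝓧 𝓨 : Type*} [Countable Γ]
    [MetricSpace 𝓧] [TopologicalSpace.SeparableSpace 𝓧] [MeasurableSpace 𝓧] [BorelSpace 𝓧]
    [NormedAddCommGroup 𝓨] [InnerProductSpace ℝ 𝓨] [CompleteSpace 𝓨]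
    [TopologicalSpace.SeparableSpace 𝓨] [MeasurableSpace 𝓨] [BorelSpace 𝓨]
    [MeasurableSpace Ω] (μ : Measure Ω) [IsProbabilityMeasure μ]
    (P : Measure (𝓧 × 𝓨)) [IsProbabilityMeasure P]
    (φ : Γ → 𝓧 → 𝓨) (κ : ℝ) (hφ : ElasticNet.BoundedFeatures φ κ)
    (w : Γ → ℝ) (hw : ∀ γ, 0 ≤ w γ)
    (βstar : ElasticNet.Ell2 Γ) (σ L : ℝ)
    (hmodel : ElasticNet.RegressionModel φ w βstar σ L P)
    (X : ℕ → Ω → 𝓧) (Y : ℕ → Ω → 𝓨) (hsample : ElasticNet.IIDSample μ P X Y) :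
    -- the case `ε > 0`, with no positive lower spectral bound required
    (∀ ε : ℝ, 0 < ε →
      ∃ βε : ElasticNet.Ell2 Γ,
        ElasticNet.IsRepresentation φ w ε P βstar βε ∧
        (∀ β', ElasticNet.IsRepresentation φ w ε P βstar β' → β' = βε) ∧
        ∀ lam : ℕ → ℝ, (∀ n, 1 ≤ n → 0 < lam n) →
          Tendsto lam atTop (𝓝 0) →
          Tendsto (fun n : ℕ => (n : ℝ) * lam n ^ 2 - 2 * Real.log n) atTop atTop →
          (∀ ω, ∀ n, 1 ≤ n →
            ∃! β, ElasticNet.IsEstimator φ w ε (lam n) n (X · ω) (Y · ω) β) ∧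
          ∀ᵐ ω ∂μ, ∀ b : ℕ → ElasticNet.Ell2 Γ,
            (∀ᶠ n in atTop,
              ElasticNet.IsEstimator φ w ε (lam n) n (X · ω) (Y · ω) (b n)) →
            Tendsto (fun n => ‖b n - βε‖) atTop (𝓝 0) ∧
            Tendsto (fun n => ElasticNet.predictionError φ P (b n) βstar) atTop (𝓝 0)) ∧
    -- the case of a positive lower spectral bound
    (∀ ε : ℝ, 0 ≤ ε → ∀ κ₀ : ℝ, 0 < κ₀ → ElasticNet.IsLowerSpectralBound φ P κ₀ →
      ∃ βε : ElasticNet.Ell2 Γ,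
        ElasticNet.IsRepresentation φ w ε P βstar βε ∧
        (∀ β', ElasticNet.IsRepresentation φ w ε P βstar β' → β' = βε) ∧
        ∀ lam : ℕ → ℝ, (∀ n, 1 ≤ n → 0 < lam n) →
          Tendsto lam atTop (𝓝 0) →
          ∀ᵐ ω ∂μ,
            (∀ᶠ n in atTop,
              ∃! β, ElasticNet.IsEstimator φ w ε (lam n) n (X · ω) (Y · ω) β) ∧
            ∀ b : ℕ → ElasticNet.Ell2 Γ,
              (∀ᶠ n in atTop,
                ElasticNet.IsEstimator φ w ε (lam n) n (X · ω) (Y · ω) (b n)) →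
              Tendsto (fun n => ‖b n - βε‖) atTop (𝓝 0) ∧
              Tendsto (fun n => ElasticNet.predictionError φ P (b n) βstar) atTop (𝓝 0)) := by
  have : SecondCountableTopology 𝓨 := UniformSpace.secondCountable_of_separable 𝓨
  refine ⟨fun ε hε => ?_, fun ε hε κ₀ hκ₀pos hκ₀ => ?_⟩
  · obtain ⟨βε, hrep, huniq⟩ :=
      hφ.existsUnique_isRepresentation (P := P) hw hε hmodel.sparse
    refine ⟨βε, hrep, huniq, fun lam hlam hlam0 hrate => ⟨fun ω n hn => ?_, ?_⟩⟩
    -- The Gram bound is taken as `c = 0`: here the penalty alone supplies strong convexity.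
    · refine hφ.existsUnique_isEstimator hw hε.le (hlam n hn).le n _ _ le_rfl (fun u => ?_) ?_
      · rw [zero_mul]
        exact hφ.inner_meanGram_nonneg _ n u
      · have := hlam n hn
        positivity
    have hlam' : ∀ᶠ n in atTop, 0 < lam n := eventually_atTop.2 ⟨1, hlam⟩
    have hfin : ElasticNet.penalty w ε βε ≠ ∞ :=
      ne_top_of_le_ne_top (ElasticNet.penalty_ne_top hmodel.sparse)
        (hrep.2 βstar (Eventually.of_forall fun _ => rfl))
    have hrate' : ∀ᶠ n : ℕ in atTop, 2 * Real.log n ≤ n * lam n ^ 2 := by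
      filter_upwards [hrate.eventually_ge_atTop 0] with n hn
      linarith
    filter_upwards [hsample.ae_tendsto_meanGram hφ,
      hsample.ae_tendsto_norm_meanScore_div hφ hmodel, hsample.ae_forall hrep.1]
      with ω hgram hscore hpred b hb
    have hscore' := hscore lam hlam' hrate'
    simp_rw [← hφ.meanScore_congr (Y · ω) hpred] at hscore'
    have ht := tendsto_iff_norm_sub_tendsto_zero.1
      (hφ.tendsto_estimator hw hε hrep hfin hlam' hlam0 hgram hscore' hb)
    exact ⟨ht, ElasticNet.tendsto_predictionError hφ hrep.1 ht⟩
  · have hrep : ElasticNet.IsRepresentation φ w ε P βstar βstar :=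
      hκ₀.isRepresentation hφ hκ₀pos
    refine ⟨βstar, hrep, fun β' hβ' => hκ₀.eq_of_predictor_ae_eq hφ hκ₀pos hβ'.1,
      fun lam hlam hlam0 => ?_⟩
    have hlam' : ∀ᶠ n in atTop, 0 < lam n := eventually_atTop.2 ⟨1, hlam⟩
    filter_upwards [hsample.ae_tendsto_meanGram hφ, hsample.ae_tendsto_meanScore hφ hmodel]
      with ω hgram hscore
    refine ⟨?_, fun b hb => ?_⟩
    · filter_upwards [hlam', hκ₀.eventually_le_inner_meanGram hφ hκ₀pos hgram] with n hln hn
      -- Since `ε` may be 0, strong convexity comes from the empirical Gram bound `κ₀ / 2`,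
      -- available only for large `n`.
      exact hφ.existsUnique_isEstimator hw hε hln.le n _ _ (half_pos hκ₀pos).le hn (by positivity)
    · have ht := hκ₀.tendsto_estimator hφ hκ₀pos (ElasticNet.penalty_ne_top hmodel.sparse) hlam'
        hlam0 hgram hscore hb
      exact ⟨ht, ElasticNet.tendsto_predictionError hφ hrep.1 ht⟩
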